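/- Let $0<q<1$, let $s>0$, and let $\kappa,\lambda\in\mathbb{R}$. Write $q^x:=e^{x\log q}$ for $x\in\mathbb{C}$, $(u;p)_\infty:=\prod_{i\ge 0}(1-up^i)$, $\theta(u;p):=(u;p)_\infty(p/u;p)_\infty$ and $\theta(u_1,\ldots,u_r;p):=\prod_{j=1}^r\theta(u_j;p)$. For real parameters $\kappa,\lambda,\upsilon,\varsigma$ and a step-size $s>0$ put \[ \widetilde a=q^{\kappa+\upsilon},\quad \widetilde b=-q^{\kappa-\upsilon},\quad \widetilde c=q^{\frac s2+\lambda+\varsigma},\quad d=-q^{\frac s2+\upsilon-\varsigma},\quad W(x,z)=q^{(\kappa+\lambda+x)(\kappa+\upsilon+z)/s}, \] and define the normalized $c$-function, a meromorphic function of $(x,z)\in\mathbb{C}^2$, by \[ c(x,z;\kappa,\lambda,\upsilon,\varsigma;q,s):=\frac{\theta\bigl(\widetilde a q^{-z},\widetilde b q^{-z},\widetilde c q^{-z},\tfrac{d}{\widetilde a}q^{x-z};q^s\bigr)}{W(x,z)\,\theta\bigl(q^{-2z},d q^x;q^s\bigr)} . \] Consider its specializations \[ \begin{aligned} c_J(x,z)&:=c(x,z;\kappa,\lambda,\kappa,\lambda;q,s),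 & c_J^d(x,z)&:=c(x,z;\kappa,\kappa,\lambda,\lambda;q,s),\\ c_R(x,z)&:=c(x,\tfrac z2;\kappa,\lambda,0,0;q,\tfrac s2), & c_R^d(x,z)&:=c(x,\tfrac z2;\kappa,0,\lambda,0;q,\tfrac s2). \end{aligned} \] Then, as identities of meromorphic functions of $(x,z)\in\mathbb{C}^2$, \[ \frac{c_J(x,-z)}{c_J^d(z,-x)}=\frac{c_R(x,-z)}{c_R^d(\frac z2,-2x)},\qquad \frac{c_J(x,z)-c_J^d(z,x)}{c_J^d(z,-x)}=\frac{c_R(x,z)-c_R^d(\frac z2,2x)}{c_R^d(\frac z2,-2x)} . \] Explicitly: for each of the two identities, the set of $(x,z)\in\mathbb{C}^2$ at which none of the denominators occurring in it (those of the quotients displayed, and those in the definition of the $c$-functions involved) vanishes is open and dense in $\mathbb{C}^2$, and the identity holds at every point of this set. -/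

import Mathlib

noncomputable section

namespace AskeyWilson

/-- The infinite `p`-shifted factorial `(u; p)_∞ = ∏_{i ≥ 0} (1 - u p ^ i)`, for `|p| < 1`. -/
def qPochInf (u p : ℂ) : ℂ := ∏' i : ℕ, (1 - u * p ^ i)

/-- The modified Jacobi theta function `θ(u; p) = (u, p / u; p)_∞`, for `u ≠ 0`, `|p| < 1`. -/
def theta (u p : ℂ) : ℂ := qPochInf u p * qPochInf (p / u) p

/-- The power `q ^ x = exp (x log q)` for `0 < q < 1` and complex `x`. -/
def qpow (q : ℝ) (x : ℂ) : ℂ := Complex.exp (x * (Real.log q : ℂ))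

/-- The dual Askey-Wilson parameter `ã = q ^ (κ + υ)`. -/
def aDual (κ ups q : ℝ) : ℂ := qpow q (κ + ups)

/-- The dual Askey-Wilson parameter `b̃ = -q ^ (κ - υ)`. -/
def bDual (κ ups q : ℝ) : ℂ := -qpow q (κ - ups)

/-- The dual Askey-Wilson parameter `c̃ = q ^ (s / 2 + λ + ς)`. -/
def cDual (lam sig q s : ℝ) : ℂ := qpow q (s / 2 + lam + sig)

/-- The Askey-Wilson parameter `d = -q ^ (s / 2 + υ - ς)`. -/
def dParam (ups sig q s : ℝ) : ℂ := -qpow q (s / 2 + ups - sig)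

/-- Functions of two complex variables `x, z`, depending on Hecke parameters `κ, λ, υ, ς`, on the
deformation parameter `q` and on the step-size `s` (in this order). -/
abbrev Family : Type := ℂ → ℂ → ℝ → ℝ → ℝ → ℝ → ℝ → ℝ → ℂ

/-- `W(x, z) = q ^ ((κ + λ + x) (κ + υ + z) / s)`. -/
def W : Family := fun x z κ lam ups _ q s => qpow q ((κ + lam + x) * (κ + ups + z) / s)

/-- The numerator `θ(ã q^{-z}, b̃ q^{-z}, c̃ q^{-z}, d q^{x-z} / ã; q^s)` of the c-function. -/
def cNum : Family := fun x z κ lam ups sig q s =>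
  theta (aDual κ ups q * qpow q (-z)) (qpow q s) *
  theta (bDual κ ups q * qpow q (-z)) (qpow q s) *
  theta (cDual lam sig q s * qpow q (-z)) (qpow q s) *
  theta (dParam ups sig q s * qpow q (x - z) / aDual κ ups q) (qpow q s)

/-- The denominator `W(x, z) θ(q^{-2z}, d q^x; q^s)` of the c-function. -/
def cDen : Family := fun x z κ lam ups sig q s =>
  W x z κ lam ups sig q s *
  (theta (qpow q (-2 * z)) (qpow q s) * theta (dParam ups sig q s * qpow q x) (qpow q s))

/-- The normalized c-function `c(x, z; κ, λ, υ, ς; q, s)`. -/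
def cFun : Family := fun x z κ lam ups sig q s =>
  cNum x z κ lam ups sig q s / cDen x z κ lam ups sig q s

/-- `Ξ_J(x, z) = Ξ(x, z; κ, λ, κ, λ; q, s)`. -/
def specJ (Ξ : Family) (κ lam q s : ℝ) (x z : ℂ) : ℂ := Ξ x z κ lam κ lam q s

/-- `Ξ_J^d(x, z) = Ξ(x, z; κ, κ, λ, λ; q, s)`. -/
def specJDual (Ξ : Family) (κ lam q s : ℝ) (x z : ℂ) : ℂ := Ξ x z κ κ lam lam q s

/-- `Ξ_R(x, z) = Ξ(x, z / 2; κ, λ, 0, 0; q, s / 2)`. -/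
def specR (Ξ : Family) (κ lam q s : ℝ) (x z : ℂ) : ℂ := Ξ x (z / 2) κ lam 0 0 q (s / 2)

/-- `Ξ_R^d(x, z) = Ξ(x, z / 2; κ, 0, λ, 0; q, s / 2)`. -/
def specRDual (Ξ : Family) (κ lam q s : ℝ) (x z : ℂ) : ℂ := Ξ x (z / 2) κ 0 lam 0 q (s / 2)

/-- The points `(x, z)` at which both sides of the identity
`c_J(x,-z) / c_J^d(z,-x) = c_R(x,-z) / c_R^d(z/2,-2x)` are defined: no denominator vanishes,
neither inside one of the four c-functions nor of one of the two quotients. -/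
def domain₁ (κ lam q s : ℝ) : Set (ℂ × ℂ) :=
  {p | specJ cDen κ lam q s p.1 (-p.2) ≠ 0 ∧
       specJDual cDen κ lam q s p.2 (-p.1) ≠ 0 ∧
       specJDual cFun κ lam q s p.2 (-p.1) ≠ 0 ∧
       specR cDen κ lam q s p.1 (-p.2) ≠ 0 ∧
       specRDual cDen κ lam q s (p.2 / 2) (-2 * p.1) ≠ 0 ∧
       specRDual cFun κ lam q s (p.2 / 2) (-2 * p.1) ≠ 0}

/-- The points `(x, z)` at which both sides of the identity
`(c_J(x,z) - c_J^d(z,x)) / c_J^d(z,-x) = (c_R(x,z) - c_R^d(z/2,2x)) / c_R^d(z/2,-2x)`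
are defined: no denominator vanishes, neither inside one of the six c-functions nor of one of the
two quotients. -/
def domain₂ (κ lam q s : ℝ) : Set (ℂ × ℂ) :=
  {p | specJ cDen κ lam q s p.1 p.2 ≠ 0 ∧
       specJDual cDen κ lam q s p.2 p.1 ≠ 0 ∧
       specJDual cDen κ lam q s p.2 (-p.1) ≠ 0 ∧
       specJDual cFun κ lam q s p.2 (-p.1) ≠ 0 ∧
       specR cDen κ lam q s p.1 p.2 ≠ 0 ∧
       specRDual cDen κ lam q s (p.2 / 2) (2 * p.1) ≠ 0 ∧
       specRDual cDen κ lam q s (p.2 / 2) (-2 * p.1) ≠ 0 ∧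
       specRDual cFun κ lam q s (p.2 / 2) (-2 * p.1) ≠ 0}

end AskeyWilson

end

open AskeyWilson

namespace AskeyWilson

open Filter Topology

/-! In the variables `ρ = q^(s/4)`, `a = q^κ`, `b = q^λ`, `X = q^x`, `t = q^(z/2)`, all the
c-functions are quotients of theta functions of nome `ρ ^ 4` (the J side) or `ρ ^ 2` (the R side),
with monomial arguments and a common prefactor `W`. The duplication formulas `θ(u; p) = θ(u, up;
p²)` and `θ(u, -u; p) = θ(u²; p²)` relate the two nomes.

The first identity then holds by cancellation. For the second, compare the two sides term by term:
the difference of the `c_J` and `c_R` contributions contains one three-term expression in triple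
theta products, and the difference of the dual contributions another. Each expression collapses to a
single product (`theta_triple_sub₁`, `theta_triple_sub₂`), and the two resulting contributions
cancel (`quotient_sub_eq_of_three_term`).

The three-term relations mix two nomes. They are proved on bilateral series, available through the
Jacobi triple product: a product of two series of nome `c` expands in nome `c ^ 2`
(`thetaSeries_mul_thetaSeries`), and one series splits into even and odd parts of nome `c ^ 4`
(`thetaSeries_eq_even_add_odd`). After expansion only polynomial identities remain.

For density, each relevant theta factor is a function of one nonzero linear form in `(x, z)` and
vanishes on only countably many of its values. -/

/-- The bilateral series `∑ c ^ (n²) w ^ n` over all integers `n`. -/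
noncomputable def thetaSeries (c w : ℂ) : ℂ := ∑' n : ℤ, c ^ (n ^ 2) * w ^ n

lemma summable_thetaSeries {c w : ℂ} (hc : c ≠ 0) (hc₁ : ‖c‖ < 1) (hw : w ≠ 0) :
    Summable fun n : ℤ => c ^ (n ^ 2) * w ^ n := by
  have hπ : (Real.pi : ℂ) ≠ 0 := by exact_mod_cast Real.pi_ne_zero
  have hI := Complex.I_ne_zero
  -- The series is `jacobiTheta₂` at `τ = log c / (πi)` and `z = log w / (2πi)`; `‖c‖ < 1` says
  -- exactly that `Im τ > 0`.
  have him : 0 < (Complex.log c / (Real.pi * Complex.I)).im := by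
    have : Complex.log c / (Real.pi * Complex.I) = -(Complex.log c * Complex.I) / (Real.pi : ℝ) := by
      field_simp
      simp
    rw [this, Complex.div_ofReal_im]
    have : Real.log ‖c‖ < 0 := Real.log_neg (norm_pos_iff.2 hc) hc₁
    simp only [Complex.neg_im, Complex.mul_im, Complex.I_re, Complex.I_im, Complex.log_re]
    apply div_pos _ Real.pi_pos
    linarith
  refine ((hasSum_jacobiTheta₂_term (Complex.log w / (2 * Real.pi * Complex.I)) him).summable).congr ?_
  intro n
  rw [jacobiTheta₂_term]
  have h1 : 2 * Real.pi * Complex.I * n * (Complex.log w / (2 * Real.pi * Complex.I)) +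
      Real.pi * Complex.I * n ^ 2 * (Complex.log c / (Real.pi * Complex.I)) =
      ((n ^ 2 : ℤ) : ℂ) * Complex.log c + (n : ℂ) * Complex.log w := by
    push_cast
    field_simp
    ring
  rw [h1, Complex.exp_add, Complex.exp_int_mul, Complex.exp_int_mul, Complex.exp_log hc,
    Complex.exp_log hw]

/-! ### Shifted factorials and central `p`-binomial coefficients -/

lemma multipliable_qPochInf (u : ℂ) {p : ℂ} (hp : ‖p‖ < 1) :
    Multipliable fun i : ℕ => 1 - u * p ^ i := by
  have : Multipliable fun i : ℕ => 1 + (-(u * p ^ i)) := by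
    apply multipliable_one_add_of_summable
    simp only [norm_neg, norm_mul, norm_pow]
    exact (summable_geometric_of_lt_one (norm_nonneg _) hp).mul_left _
  simpa only [sub_eq_add_neg] using this

lemma qPochInf_ne_zero {u p : ℂ} (hp : ‖p‖ < 1) (h : ∀ i : ℕ, u * p ^ i ≠ 1) :
    qPochInf u p ≠ 0 := by
  have : ∏' i : ℕ, (1 + (-(u * p ^ i))) ≠ 0 := by
    apply tprod_one_add_ne_zero_of_summable
    · intro i hi
      exact h i (by linear_combination -hi)
    · simp only [norm_neg, norm_mul, norm_pow]
      exact (summable_geometric_of_lt_one (norm_nonneg _) hp).mul_left _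
  simpa only [qPochInf, sub_eq_add_neg] using this

/-- The finite shifted factorial `(p; p)_n`. -/
noncomputable def qFactorial (p : ℂ) (n : ℕ) : ℂ := ∏ i ∈ Finset.range n, (1 - p * p ^ i)

/-- The reciprocal `1 / (p; p)_k`, extended by zero to negative integers `k`. -/
noncomputable def qFactorialInv (p : ℂ) (k : ℤ) : ℂ := if k < 0 then 0 else (qFactorial p k.toNat)⁻¹

lemma pow_ne_one_of_norm_lt_one {p : ℂ} (hp : ‖p‖ < 1) (i : ℕ) : p * p ^ i ≠ 1 := by
  intro h
  have := congrArg norm h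
  rw [← pow_succ', norm_pow, norm_one] at this
  exact (pow_lt_one₀ (norm_nonneg _) hp (Nat.succ_ne_zero i)).ne this

lemma qFactorial_ne_zero {p : ℂ} (hp : ‖p‖ < 1) (n : ℕ) : qFactorial p n ≠ 0 :=
  Finset.prod_ne_zero_iff.2 fun i _ => sub_ne_zero.2 (pow_ne_one_of_norm_lt_one hp i).symm

/-- The extension by zero is consistent with this recursion because `1 - p ^ k` vanishes at `k = 0`;
no boundary cases are then needed in later index shifts. -/
lemma qFactorialInv_sub_one {p : ℂ} (hp : ‖p‖ < 1) (k : ℤ) :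
    qFactorialInv p (k - 1) = (1 - p ^ k) * qFactorialInv p k := by
  unfold qFactorialInv
  rcases lt_trichotomy k 0 with hk | rfl | hk
  · simp [hk, show k - 1 < 0 by omega]
  · simp
  · obtain ⟨n, rfl⟩ : ∃ n : ℕ, k = (n : ℤ) + 1 := ⟨(k - 1).toNat, by omega⟩
    have h1 : ¬ ((n : ℤ) + 1 < 0) := by omega
    have h2 : ¬ ((n : ℤ) + 1 - 1 < 0) := by omega
    have h3 : ((n : ℤ) + 1).toNat = n + 1 := by omega
    have h4 : ((n : ℤ) + 1 - 1).toNat = n := by omega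
    rw [if_neg h1, if_neg h2, h3, h4]
    have h5 : qFactorial p (n + 1) = qFactorial p n * (1 - p * p ^ n) := by
      simp [qFactorial, Finset.prod_range_succ]
    have h6 : p ^ ((n : ℤ) + 1) = p * p ^ n := by
      rw [← pow_succ']; exact_mod_cast zpow_natCast p (n + 1)
    have h7 := qFactorial_ne_zero hp n
    have h8 : 1 - p * p ^ n ≠ 0 := sub_ne_zero.2 (pow_ne_one_of_norm_lt_one hp n).symm
    rw [h5, h6]
    field_simp

/-- The central `p`-binomial coefficient `[2n, n + k]`. -/
noncomputable def qCentralBinom (p : ℂ) (n : ℕ) (k : ℤ) : ℂ :=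
  qFactorial p (2 * n) * (qFactorialInv p (n - k) * qFactorialInv p (n + k))

lemma qCentralBinom_succ {p : ℂ} (hp₀ : p ≠ 0) (hp : ‖p‖ < 1) (n : ℕ) (k : ℤ) :
    qCentralBinom p (n + 1) k = (1 + p ^ (2 * n + 1)) * qCentralBinom p n k
      + (p ^ ((n : ℤ) + 1 - k) * qCentralBinom p n (k - 1)
      + p ^ ((n : ℤ) + 1 + k) * qCentralBinom p n (k + 1)) := by
  unfold qCentralBinom
  -- Everything is expressed through the reciprocals at `n + 1 - k` and `n + 1 + k`, leaving a
  -- rational identity in `p ^ n` and `p ^ k`.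
  have e1 : qFactorialInv p ((n : ℤ) - k) =
      (1 - p ^ ((n : ℤ) + 1 - k)) * qFactorialInv p ((n : ℤ) + 1 - k) := by
    rw [← qFactorialInv_sub_one hp]; congr 1; ring
  have e2 : qFactorialInv p ((n : ℤ) + k) =
      (1 - p ^ ((n : ℤ) + 1 + k)) * qFactorialInv p ((n : ℤ) + 1 + k) := by
    rw [← qFactorialInv_sub_one hp]; congr 1; ring
  have e3 : qFactorialInv p ((n : ℤ) - (k - 1)) = qFactorialInv p ((n : ℤ) + 1 - k) := by
    congr 1; ring
  have e4 : qFactorialInv p ((n : ℤ) + (k - 1)) =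
      (1 - p ^ ((n : ℤ) + k)) * ((1 - p ^ ((n : ℤ) + 1 + k)) * qFactorialInv p ((n : ℤ) + 1 + k)) := by
    rw [← e2, ← qFactorialInv_sub_one hp]; congr 1; ring
  have e5 : qFactorialInv p ((n : ℤ) - (k + 1)) =
      (1 - p ^ ((n : ℤ) - k)) * ((1 - p ^ ((n : ℤ) + 1 - k)) * qFactorialInv p ((n : ℤ) + 1 - k)) := by
    rw [← e1, ← qFactorialInv_sub_one hp]; congr 1; ring
  have e6 : qFactorialInv p ((n : ℤ) + (k + 1)) = qFactorialInv p ((n : ℤ) + 1 + k) := by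
    congr 1; ring
  have e7 : qFactorial p (2 * (n + 1)) =
      qFactorial p (2 * n) * (1 - p * p ^ (2 * n)) * (1 - p * p ^ (2 * n + 1)) := by
    simp [qFactorial, Finset.prod_range_succ, mul_add]
  have hn : p ^ (n : ℤ) = p ^ n := zpow_natCast p n
  have hp2 : p ^ (2 * n) = p ^ n * p ^ n := by rw [two_mul, pow_add]
  push_cast
  rw [e1, e2, e3, e4, e5, e6, e7]
  simp only [zpow_add₀ hp₀, zpow_sub₀ hp₀, zpow_one, hn, pow_succ, hp2]
  have hk : p ^ k ≠ 0 := zpow_ne_zero _ hp₀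
  field_simp
  ring

lemma hasSum_finite_tripleProduct {c w : ℂ} (hc : c ≠ 0) (hc₁ : ‖c‖ < 1) (hw : w ≠ 0) (n : ℕ) :
    HasSum (fun k : ℤ => qCentralBinom (c ^ 2) n k * (c ^ (k ^ 2) * w ^ k))
      (∏ i ∈ Finset.range n, ((1 + c * w * (c ^ 2) ^ i) * (1 + c / w * (c ^ 2) ^ i))) := by
  have hp : ‖c ^ 2‖ < 1 := by
    rw [norm_pow]; exact pow_lt_one₀ (norm_nonneg _) hc₁ two_ne_zero
  have hp₀ : c ^ 2 ≠ 0 := pow_ne_zero _ hc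
  induction n with
  | zero =>
    have h := hasSum_single (f := fun k : ℤ => qCentralBinom (c ^ 2) 0 k * (c ^ (k ^ 2) * w ^ k)) 0 ?_
    · simpa [qCentralBinom, qFactorialInv, qFactorial] using h
    · intro k hk
      rcases lt_or_gt_of_ne hk with h | h
      · simp [qCentralBinom, qFactorialInv, h]
      · simp [qCentralBinom, qFactorialInv, h]
  | succ n ih =>
    have s1 := (Equiv.subRight (1 : ℤ)).hasSum_iff.2 ih
    have s2 := (Equiv.addRight (1 : ℤ)).hasSum_iff.2 ih
    -- With `p = c ^ 2`, the new factor is `1 + p ^ (2n+1) + c p ^ n (w + 1/w)`; the terms in `w`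
    -- and `1/w` shift the summation index by one.
    have h := (ih.mul_left (1 + (c ^ 2) ^ (2 * n + 1))).add
      ((s1.mul_left (c * (c ^ 2) ^ n * w)).add (s2.mul_left (c * (c ^ 2) ^ n / w)))
    rw [Finset.prod_range_succ]
    convert! h using 1
    · funext k
      rw [qCentralBinom_succ hp₀ hp]
      simp only [Function.comp_apply, Equiv.subRight_apply, Equiv.coe_addRight]
      have e1 : (c ^ 2) ^ ((n : ℤ) + 1 - k) * c ^ (k ^ 2) = c * (c ^ 2) ^ n * c ^ ((k - 1) ^ 2) := by
        rw [← zpow_natCast (c ^ 2) n, ← zpow_ofNat c 2, ← zpow_mul, ← zpow_mul, ← zpow_add₀ hc,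
          ← zpow_one_add₀ hc, ← zpow_add₀ hc]
        congr 1; ring
      have e2 : (c ^ 2) ^ ((n : ℤ) + 1 + k) * c ^ (k ^ 2) = c * (c ^ 2) ^ n * c ^ ((k + 1) ^ 2) := by
        rw [← zpow_natCast (c ^ 2) n, ← zpow_ofNat c 2, ← zpow_mul, ← zpow_mul, ← zpow_add₀ hc,
          ← zpow_one_add₀ hc, ← zpow_add₀ hc]
        congr 1; ring
      have e3 : w ^ (k - 1) * w = w ^ k := by rw [← zpow_add_one₀ hw]; simp
      have e4 : w ^ (k + 1) * w⁻¹ = w ^ k := by rw [zpow_add_one₀ hw]; field_simp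
      generalize qCentralBinom (c ^ 2) n k = A
      generalize qCentralBinom (c ^ 2) n (k - 1) = B
      generalize qCentralBinom (c ^ 2) n (k + 1) = C
      rw [div_eq_mul_inv]
      linear_combination (B * w ^ k) * e1 + (C * w ^ k) * e2 - c * (c ^ 2) ^ n * c ^ ((k - 1) ^ 2) * B * e3
        - c * (c ^ 2) ^ n * c ^ ((k + 1) ^ 2) * C * e4
    · field_simp
      ring

lemma tendsto_qFactorial {p : ℂ} (hp : ‖p‖ < 1) :
    Tendsto (qFactorial p) atTop (𝓝 (qPochInf p p)) :=
  (multipliable_qPochInf p hp).tendsto_prod_tprod_nat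

lemma qPochInf_self_ne_zero {p : ℂ} (hp : ‖p‖ < 1) : qPochInf p p ≠ 0 :=
  qPochInf_ne_zero hp (pow_ne_one_of_norm_lt_one hp)

lemma tendsto_qFactorialInv {p : ℂ} (hp : ‖p‖ < 1) :
    Tendsto (qFactorialInv p) atTop (𝓝 (qPochInf p p)⁻¹) := by
  have h1 : Tendsto (fun k : ℤ => (qFactorial p k.toNat)⁻¹) atTop (𝓝 (qPochInf p p)⁻¹) :=
    ((tendsto_qFactorial hp).inv₀ (qPochInf_self_ne_zero hp)).comp
      (tendsto_atTop_atTop.2 fun b => ⟨b, fun a ha => by omega⟩)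
  refine h1.congr' ?_
  filter_upwards [eventually_ge_atTop 0] with k hk
  rw [qFactorialInv, if_neg (not_lt.2 hk)]

/-- Uniformity in both `n` and `k` provides the dominating series when `n → ∞` in the finite triple
product. -/
lemma exists_norm_qCentralBinom_le {p : ℂ} (hp : ‖p‖ < 1) :
    ∃ C : ℝ, ∀ n k, ‖qCentralBinom p n k‖ ≤ C := by
  obtain ⟨A, hA⟩ := (tendsto_qFactorial hp).norm.bddAbove_range
  obtain ⟨B, hB⟩ := ((tendsto_qFactorial hp).inv₀ (qPochInf_self_ne_zero hp)).norm.bddAbove_range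
  have hA' : ∀ n, ‖qFactorial p n‖ ≤ A := fun n => hA ⟨n, rfl⟩
  have hB' : ∀ n, ‖(qFactorial p n)⁻¹‖ ≤ B := fun n => hB ⟨n, rfl⟩
  have hA₀ : 0 ≤ A := (norm_nonneg _).trans (hA' 0)
  have hB₀ : 0 ≤ B := (norm_nonneg _).trans (hB' 0)
  have hQ : ∀ k, ‖qFactorialInv p k‖ ≤ B := by
    intro k
    unfold qFactorialInv
    split_ifs
    · simpa using hB₀
    · exact hB' _
  refine ⟨A * (B * B), fun n k => ?_⟩
  rw [qCentralBinom, norm_mul, norm_mul]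
  gcongr
  · exact hA' _
  · exact hQ _
  · exact hQ _

/-- The Jacobi triple product identity. -/
theorem thetaSeries_eq_mul_qPochInf {c w : ℂ} (hc : c ≠ 0) (hc₁ : ‖c‖ < 1) (hw : w ≠ 0) :
    thetaSeries c w =
      qPochInf (c ^ 2) (c ^ 2) * (qPochInf (-(c * w)) (c ^ 2) * qPochInf (-(c / w)) (c ^ 2)) := by
  have hp : ‖c ^ 2‖ < 1 := by
    rw [norm_pow]; exact pow_lt_one₀ (norm_nonneg _) hc₁ two_ne_zero
  have hK := qPochInf_self_ne_zero hp
  have hL : Tendsto (fun n => ∏ i ∈ Finset.range n,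
      ((1 + c * w * (c ^ 2) ^ i) * (1 + c / w * (c ^ 2) ^ i))) atTop
      (𝓝 (qPochInf (-(c * w)) (c ^ 2) * qPochInf (-(c / w)) (c ^ 2))) := by
    simp_rw [Finset.prod_mul_distrib]
    have h1 := (multipliable_qPochInf (-(c * w)) hp).tendsto_prod_tprod_nat
    have h2 := (multipliable_qPochInf (-(c / w)) hp).tendsto_prod_tprod_nat
    simpa only [neg_mul, sub_neg_eq_add, qPochInf] using h1.mul h2
  obtain ⟨C, hC⟩ := exists_norm_qCentralBinom_le hp
  have hR : Tendsto (fun n : ℕ => ∑' k : ℤ, qCentralBinom (c ^ 2) n k * (c ^ (k ^ 2) * w ^ k)) atTop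
      (𝓝 (∑' k : ℤ, (qPochInf (c ^ 2) (c ^ 2))⁻¹ * (c ^ (k ^ 2) * w ^ k))) := by
    refine tendsto_tsum_of_dominated_convergence
      (bound := fun k : ℤ => C * ‖c ^ (k ^ 2) * w ^ k‖)
      ((summable_thetaSeries hc hc₁ hw).norm.mul_left C) ?_ ?_
    · intro k
      refine Tendsto.mul_const _ ?_
      have h1 : Tendsto (fun n : ℕ => qFactorialInv (c ^ 2) ((n : ℤ) - k)) atTop
          (𝓝 (qPochInf (c ^ 2) (c ^ 2))⁻¹) :=
        (tendsto_qFactorialInv hp).comp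
          (tendsto_atTop_add_const_right _ (-k) tendsto_natCast_atTop_atTop)
      have h2 : Tendsto (fun n : ℕ => qFactorialInv (c ^ 2) ((n : ℤ) + k)) atTop
          (𝓝 (qPochInf (c ^ 2) (c ^ 2))⁻¹) :=
        (tendsto_qFactorialInv hp).comp
          (tendsto_atTop_add_const_right _ k tendsto_natCast_atTop_atTop)
      have h3 : Tendsto (fun n : ℕ => qFactorial (c ^ 2) (2 * n)) atTop
          (𝓝 (qPochInf (c ^ 2) (c ^ 2))) :=
        (tendsto_qFactorial hp).comp (tendsto_id.const_mul_atTop' two_pos)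
      have h4 := h3.mul (h1.mul h2)
      rwa [mul_inv_cancel_left₀ hK] at h4
    · refine Eventually.of_forall fun n k => ?_
      rw [norm_mul]
      exact mul_le_mul_of_nonneg_right (hC n k) (norm_nonneg _)
  have hR' := hR.congr fun n => (hasSum_finite_tripleProduct hc hc₁ hw n).tsum_eq
  have h := tendsto_nhds_unique hL hR'
  rw [tsum_mul_left] at h
  rw [h, thetaSeries, mul_inv_cancel_left₀ hK]

/-! ### Symmetry, quasi-periodicity and parity splittings of the series -/

lemma thetaSeries_inv (c w : ℂ) : thetaSeries c w⁻¹ = thetaSeries c w := by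
  unfold thetaSeries
  rw [← (Equiv.neg ℤ).tsum_eq]
  simp

/-- Completing the square, `n² + 2n = (n + 1)² - 1`, turns the extra factor into an index shift. -/
lemma thetaSeries_sq_mul {c w : ℂ} (hc : c ≠ 0) (hw : w ≠ 0) :
    thetaSeries c (c ^ 2 * w) = thetaSeries c w / (c * w) := by
  unfold thetaSeries
  rw [div_eq_inv_mul, ← tsum_mul_left, ← (Equiv.addRight (1 : ℤ)).tsum_eq
    (fun n : ℤ => (c * w)⁻¹ * (c ^ (n ^ 2) * w ^ n))]
  refine tsum_congr fun n => ?_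
  have e1 : (c ^ 2) ^ n * c ^ (n ^ 2) = c ^ ((n + 1) ^ 2) * c⁻¹ := by
    rw [← zpow_ofNat c 2, ← zpow_mul, ← zpow_add₀ hc, ← zpow_sub_one₀ hc]
    congr 1; ring
  have e2 : w ^ (n + 1) * w⁻¹ = w ^ n := by rw [zpow_add_one₀ hw]; field_simp
  simp only [Equiv.coe_addRight, mul_zpow, mul_inv]
  linear_combination w ^ n * e1 - c ^ ((n + 1) ^ 2) * c⁻¹ * e2

lemma tsum_eq_add_of_isCompl_range {ι β : Type*} {f : β → ℂ} {g h : ι → β} (hs : Summable f)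
    (hg : Function.Injective g) (hh : Function.Injective h)
    (hgh : IsCompl (Set.range g) (Set.range h)) :
    ∑' b, f b = ∑' i, f (g i) + ∑' i, f (h i) := by
  have h0 : HasSum (f ∘ ((↑) : Set.range g → β)) (∑' i, f (g i)) :=
    hg.hasSum_range_iff.2 (hs.comp_injective hg).hasSum
  have h1 : HasSum (f ∘ ((↑) : Set.range h → β)) (∑' i, f (h i)) :=
    hh.hasSum_range_iff.2 (hs.comp_injective hh).hasSum
  exact (h0.add_isCompl hgh h1).tsum_eq

/-- Decomposition of a bilateral series into its even and odd parts. -/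
lemma thetaSeries_eq_even_add_odd {c w : ℂ} (hc : c ≠ 0) (hc₁ : ‖c‖ < 1) (hw : w ≠ 0) :
    thetaSeries c w = thetaSeries (c ^ 4) (w ^ 2) + c * w * thetaSeries (c ^ 4) (c ^ 4 * w ^ 2) := by
  have hs := summable_thetaSeries hc hc₁ hw
  have hi0 : Function.Injective fun m : ℤ => 2 * m := fun a b h => by simpa using h
  have hi1 : Function.Injective fun m : ℤ => 2 * m + 1 := fun a b h => by simpa using h
  have hcompl : IsCompl (Set.range fun m : ℤ => 2 * m) (Set.range fun m : ℤ => 2 * m + 1) := by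
    constructor
    · rw [Set.disjoint_left]
      rintro _ ⟨a, rfl⟩ ⟨b, hb⟩
      dsimp only at hb
      omega
    · rw [codisjoint_iff_le_sup]
      rintro n -
      rcases Int.even_or_odd' n with ⟨m, h | h⟩
      · exact Or.inl ⟨m, h.symm⟩
      · exact Or.inr ⟨m, h.symm⟩
  rw [thetaSeries, tsum_eq_add_of_isCompl_range hs hi0 hi1 hcompl, thetaSeries, thetaSeries, ← tsum_mul_left]
  congr 1
  · refine tsum_congr fun m => ?_
    rw [← zpow_ofNat c 4, ← zpow_ofNat w 2, ← zpow_mul, ← zpow_mul]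
    congr 2; ring
  · refine tsum_congr fun m => ?_
    rw [mul_zpow, ← zpow_ofNat c 4, ← zpow_ofNat w 2, ← zpow_mul, ← zpow_mul, ← zpow_mul,
      zpow_add_one₀ hw, show (2 * m + 1) ^ 2 = 4 * m ^ 2 + 4 * m + 1 by ring, zpow_add_one₀ hc,
      zpow_add₀ hc]
    ring

/-- The product of two bilateral series of nome `c` in terms of series of nome `c ^ 2`. -/
theorem thetaSeries_mul_thetaSeries {c u v : ℂ} (hc : c ≠ 0) (hc₁ : ‖c‖ < 1) (hu : u ≠ 0)
    (hv : v ≠ 0) :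
    thetaSeries c u * thetaSeries c v =
      thetaSeries (c ^ 2) (u * v) * thetaSeries (c ^ 2) (u / v) +
        c * u * (thetaSeries (c ^ 2) (c ^ 2 * (u * v)) * thetaSeries (c ^ 2) (c ^ 2 * (u / v))) := by
  have hp : ‖c ^ 2‖ < 1 := by
    rw [norm_pow]; exact pow_lt_one₀ (norm_nonneg _) hc₁ two_ne_zero
  have hp₀ : c ^ 2 ≠ 0 := pow_ne_zero _ hc
  have hsu := (summable_thetaSeries hc hc₁ hu).norm
  have hsv := (summable_thetaSeries hc hc₁ hv).norm
  have hs := summable_mul_of_summable_norm hsu hsv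
  have hprod : ∀ a b : ℂ, a ≠ 0 → b ≠ 0 → thetaSeries (c ^ 2) a * thetaSeries (c ^ 2) b =
      ∑' k : ℤ × ℤ, (c ^ 2) ^ (k.1 ^ 2) * a ^ k.1 * ((c ^ 2) ^ (k.2 ^ 2) * b ^ k.2) := fun a b ha hb =>
    tsum_mul_tsum_of_summable_norm (summable_thetaSeries hp₀ hp ha).norm
      (summable_thetaSeries hp₀ hp hb).norm
  -- Pairs `(n, m)` with `n - m` even are `(k + l, k - l)`, the others `(k + l + 1, k - l)`. In the
  -- exponent, `(k + l)² + (k - l)² = 2k² + 2l²` doubles the nome.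
  have hi0 : Function.Injective fun k : ℤ × ℤ => (k.1 + k.2, k.1 - k.2) := by
    rintro ⟨a, b⟩ ⟨a', b'⟩ h
    simp only [Prod.mk.injEq] at h ⊢
    omega
  have hi1 : Function.Injective fun k : ℤ × ℤ => (k.1 + k.2 + 1, k.1 - k.2) := by
    rintro ⟨a, b⟩ ⟨a', b'⟩ h
    simp only [Prod.mk.injEq] at h ⊢
    omega
  have hcompl : IsCompl (Set.range fun k : ℤ × ℤ => (k.1 + k.2, k.1 - k.2))
      (Set.range fun k : ℤ × ℤ => (k.1 + k.2 + 1, k.1 - k.2)) := by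
    constructor
    · rw [Set.disjoint_left]
      rintro _ ⟨⟨a, b⟩, rfl⟩ ⟨⟨a', b'⟩, hb⟩
      simp only [Prod.mk.injEq] at hb
      omega
    · rw [codisjoint_iff_le_sup]
      rintro ⟨n, m⟩ -
      rcases Int.even_or_odd' (n - m) with ⟨l, h | h⟩
      · exact Or.inl ⟨(m + l, l), by simp only [Prod.mk.injEq]; omega⟩
      · exact Or.inr ⟨(m + l, l), by simp only [Prod.mk.injEq]; omega⟩
  rw [hprod _ _ (mul_ne_zero hu hv) (div_ne_zero hu hv),
    hprod _ _ (mul_ne_zero hp₀ (mul_ne_zero hu hv)) (mul_ne_zero hp₀ (div_ne_zero hu hv)),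
    thetaSeries, thetaSeries, tsum_mul_tsum_of_summable_norm hsu hsv,
    tsum_eq_add_of_isCompl_range hs hi0 hi1 hcompl, ← tsum_mul_left]
  congr 1
  · refine tsum_congr fun ⟨k, l⟩ => ?_
    dsimp only
    have e : c ^ ((k + l) ^ 2) * c ^ ((k - l) ^ 2) = (c ^ 2) ^ (k ^ 2) * (c ^ 2) ^ (l ^ 2) := by
      rw [← zpow_ofNat c 2, ← zpow_mul, ← zpow_mul, ← zpow_add₀ hc, ← zpow_add₀ hc]
      congr 1; ring
    simp only [mul_zpow, div_zpow, zpow_add₀ hu, zpow_sub₀ hv]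
    linear_combination (u ^ k * u ^ l * (v ^ k / v ^ l)) * e
  · refine tsum_congr fun ⟨k, l⟩ => ?_
    dsimp only
    have e : c ^ ((k + l + 1) ^ 2) * c ^ ((k - l) ^ 2) =
        c * ((c ^ 2) ^ (k ^ 2) * (c ^ 2) ^ k * ((c ^ 2) ^ (l ^ 2) * (c ^ 2) ^ l)) := by
      rw [← zpow_ofNat c 2]
      simp only [← zpow_mul, ← zpow_add₀ hc, ← zpow_one_add₀ hc]
      congr 1; ring
    simp only [mul_zpow, div_zpow, zpow_add₀ hu, zpow_sub₀ hv, zpow_one]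
    linear_combination (u ^ k * u ^ l * u * (v ^ k / v ^ l)) * e

/-! ### Theta functions as series; inversion and duplication -/

lemma qPochInf_self_mul_theta {c u : ℂ} (hc : c ≠ 0) (hc₁ : ‖c‖ < 1) (hu : u ≠ 0) :
    qPochInf (c ^ 2) (c ^ 2) * theta u (c ^ 2) = thetaSeries c (-(u / c)) := by
  -- With `w = -(u / c)`, the arguments `-(c w)` and `-(c / w)` of the triple product become `u` and
  -- `c ^ 2 / u`.
  rw [thetaSeries_eq_mul_qPochInf hc hc₁ (neg_ne_zero.2 (div_ne_zero hu hc)), theta]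
  congr 3
  · field_simp
  · field_simp

lemma theta_div {u p : ℂ} (hp : p ≠ 0) : theta (p / u) p = theta u p := by
  rw [theta, theta, div_div_cancel₀ hp, mul_comm]

lemma theta_inv {c u : ℂ} (hc : c ≠ 0) (hc₁ : ‖c‖ < 1) (hu : u ≠ 0) :
    theta u⁻¹ (c ^ 2) = -(u⁻¹ * theta u (c ^ 2)) := by
  have hp : ‖c ^ 2‖ < 1 := by
    rw [norm_pow]; exact pow_lt_one₀ (norm_nonneg _) hc₁ two_ne_zero
  have hK := qPochInf_self_ne_zero hp
  apply mul_left_cancel₀ hK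
  rw [mul_neg, mul_left_comm, qPochInf_self_mul_theta hc hc₁ hu,
    qPochInf_self_mul_theta hc hc₁ (inv_ne_zero hu), ← thetaSeries_inv,
    show (-(u⁻¹ / c))⁻¹ = c ^ 2 * (-(u / c)) by field_simp,
    thetaSeries_sq_mul hc (neg_ne_zero.2 (div_ne_zero hu hc))]
  field_simp

lemma qPochInf_eq_mul_sq {p : ℂ} (hp : ‖p‖ < 1) (u : ℂ) :
    qPochInf u p = qPochInf u (p ^ 2) * qPochInf (u * p) (p ^ 2) := by
  have hp' : ‖p ^ 2‖ < 1 := by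
    rw [norm_pow]; exact pow_lt_one₀ (norm_nonneg _) hp two_ne_zero
  have h0 := multipliable_qPochInf u hp'
  have h1 := multipliable_qPochInf (u * p) hp'
  unfold qPochInf
  rw [← tprod_even_mul_odd (f := fun i : ℕ => 1 - u * p ^ i)]
  · congr 1
    · exact tprod_congr fun i => by rw [pow_mul]
    · exact tprod_congr fun i => by rw [pow_succ p, pow_mul]; ring
  · exact h0.congr fun i => by rw [pow_mul]
  · exact h1.congr fun i => by ring

lemma qPochInf_mul_neg {p : ℂ} (hp : ‖p‖ < 1) (u : ℂ) :
    qPochInf u p * qPochInf (-u) p = qPochInf (u ^ 2) (p ^ 2) := by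
  unfold qPochInf
  rw [← (multipliable_qPochInf u hp).tprod_mul (multipliable_qPochInf (-u) hp)]
  exact tprod_congr fun i => by rw [← pow_mul, mul_comm 2 i, pow_mul]; ring

lemma theta_eq_mul_sq {p u : ℂ} (hp₀ : p ≠ 0) (hp : ‖p‖ < 1) (hu : u ≠ 0) :
    theta u p = theta u (p ^ 2) * theta (u * p) (p ^ 2) := by
  unfold theta
  rw [qPochInf_eq_mul_sq hp u, qPochInf_eq_mul_sq hp (p / u),
    show p / u * p = p ^ 2 / u by ring, show p ^ 2 / (u * p) = p / u by field_simp]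
  ring

lemma theta_mul_neg {p : ℂ} (hp : ‖p‖ < 1) (u : ℂ) :
    theta u p * theta (-u) p = theta (u ^ 2) (p ^ 2) := by
  unfold theta
  rw [← qPochInf_mul_neg hp u, ← div_pow, ← qPochInf_mul_neg hp (p / u), div_neg]
  ring

/-! ### Three-term relations with mixed nomes `ρ ^ 2` and `ρ ^ 4` -/

section TripleProducts

variable {ρ a b X t : ℂ}

lemma norm_sq_lt_one (hρ₁ : ‖ρ‖ < 1) : ‖ρ ^ 2‖ < 1 := by
  rw [norm_pow]; exact pow_lt_one₀ (norm_nonneg _) hρ₁ two_ne_zero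

/-- Both pairs of nome-`ρ` factors have the same product of arguments, `bX/a`. In nome `ρ ^ 2` their
even parts give equal triple products and cancel; the odd parts share the factor at `ρ²bX/a`, and
what remains is the expansion of the last two factors on the right. -/
lemma thetaSeries_triple_sub₁ (hρ : ρ ≠ 0) (hρ₁ : ‖ρ‖ < 1) (ha : a ≠ 0) (hb : b ≠ 0) (hX : X ≠ 0)
    (ht : t ≠ 0) :
    thetaSeries (ρ ^ 2) (X / (a * b * t ^ 2)) * thetaSeries ρ (b / t) * thetaSeries ρ (t * X / a) -
      thetaSeries ρ (b * t) * thetaSeries ρ (X / (a * t)) * thetaSeries (ρ ^ 2) (t ^ 2 * X / (a * b))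
    = ρ * (b / t) * thetaSeries (ρ ^ 2) (ρ ^ 2 * (b * X / a)) * thetaSeries ρ (-(ρ / t ^ 2)) *
      thetaSeries ρ (-(ρ * (a * b) / X)) := by
  have hr₀ : ρ ^ 2 ≠ 0 := pow_ne_zero _ hρ
  rw [mul_assoc, thetaSeries_mul_thetaSeries hρ hρ₁ (u := b / t) (v := t * X / a) (by positivity)
      (by positivity),
    thetaSeries_mul_thetaSeries hρ hρ₁ (u := b * t) (v := X / (a * t)) (by positivity)
      (by positivity),
    mul_assoc _ (thetaSeries ρ (-(ρ / t ^ 2))),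
    thetaSeries_mul_thetaSeries hρ hρ₁ (u := -(ρ / t ^ 2)) (v := -(ρ * (a * b) / X))
      (neg_ne_zero.2 (by positivity)) (neg_ne_zero.2 (by positivity))]
  have e1 : b / t * (t * X / a) = b * X / a := by field_simp
  have e2 : b * t * (X / (a * t)) = b * X / a := by field_simp
  have e3 : b / t / (t * X / a) = (t ^ 2 * X / (a * b))⁻¹ := by field_simp
  have e4 : b * t / (X / (a * t)) = (X / (a * b * t ^ 2))⁻¹ := by field_simp
  have e5 : -(ρ / t ^ 2) * -(ρ * (a * b) / X) = ρ ^ 2 * (t ^ 2 * X / (a * b))⁻¹ := by field_simp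
  have e6 : -(ρ / t ^ 2) / -(ρ * (a * b) / X) = X / (a * b * t ^ 2) := by field_simp
  -- A quasi-period and inversion bring the arguments `ρ⁴/y` and `ρ²/y'` back to `y` and `ρ²y'`,
  -- where `y = t²X/(ab)` and `y' = X/(abt²)`.
  have h1 := thetaSeries_sq_mul hr₀ (w := (t ^ 2 * X / (a * b))⁻¹ * ρ ^ 2 / ρ ^ 2) (by positivity)
  have h2 := thetaSeries_sq_mul hr₀ (w := (ρ ^ 2 * (X / (a * b * t ^ 2)))⁻¹) (by positivity)
  rw [e1, e2, e3, e4, e5, e6]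
  rw [thetaSeries_inv] at h2
  rw [mul_div_cancel_right₀ _ hr₀, thetaSeries_inv] at h1
  rw [show (ρ ^ 2) ^ 2 * (ρ ^ 2 * (X / (a * b * t ^ 2)))⁻¹ = ρ ^ 2 * (X / (a * b * t ^ 2))⁻¹ by
    field_simp] at h2
  rw [show ρ ^ 2 * (ρ ^ 2 * (t ^ 2 * X / (a * b))⁻¹) = (ρ ^ 2) ^ 2 * (t ^ 2 * X / (a * b))⁻¹ by ring,
    h1, h2, thetaSeries_inv, thetaSeries_inv]
  field_simp
  ring

/-- Everything is expanded in nome `ρ ^ 4` at the arguments `t²/b²`, `t²/(a²X²)`, `t²X²/a²` and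
their multiples by `ρ⁴`. The purely even and purely odd triple products cancel; the mixed ones
factor into the even-odd splitting at `-(t/b)` times a two-term expression, itself the product of
the last two series. -/
lemma thetaSeries_triple_sub₂ (hρ : ρ ≠ 0) (hρ₁ : ‖ρ‖ < 1) (ha : a ≠ 0) (hb : b ≠ 0) (hX : X ≠ 0)
    (ht : t ≠ 0) :
    thetaSeries (ρ ^ 2) (t ^ 2 / (a * b * X)) * thetaSeries (ρ ^ 2) (a * X / b) *
        thetaSeries ρ (t * X / a) -
      thetaSeries (ρ ^ 2) (t ^ 2 * X / (a * b)) * thetaSeries (ρ ^ 2) (a / (b * X)) *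
        thetaSeries ρ (t / (a * X))
    = ρ * (t * X / a) * thetaSeries ρ (-(t / b)) * thetaSeries (ρ ^ 2) (-(ρ ^ 2 * (t ^ 2 / a ^ 2))) *
      thetaSeries (ρ ^ 2) (-(ρ ^ 2 * X ^ 2)) := by
  have hr₀ : ρ ^ 2 ≠ 0 := pow_ne_zero _ hρ
  have hr := norm_sq_lt_one hρ₁
  have h1 := thetaSeries_mul_thetaSeries hr₀ hr (u := t ^ 2 / (a * b * X)) (v := a * X / b)
    (by positivity) (by positivity)
  have h2 := thetaSeries_mul_thetaSeries hr₀ hr (u := t ^ 2 * X / (a * b)) (v := a / (b * X))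
    (by positivity) (by positivity)
  have h3 := thetaSeries_mul_thetaSeries hr₀ hr (u := -(ρ ^ 2 * (t ^ 2 / a ^ 2)))
    (v := -(ρ ^ 2 * X ^ 2)) (neg_ne_zero.2 (by positivity)) (neg_ne_zero.2 (by positivity))
  have h4 := thetaSeries_eq_even_add_odd hρ hρ₁ (w := t * X / a) (by positivity)
  have h5 := thetaSeries_eq_even_add_odd hρ hρ₁ (w := t / (a * X)) (by positivity)
  have h6 := thetaSeries_eq_even_add_odd hρ hρ₁ (w := -(t / b)) (neg_ne_zero.2 (by positivity))
  rw [show t ^ 2 / (a * b * X) * (a * X / b) = t ^ 2 / b ^ 2 by field_simp,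
    show t ^ 2 / (a * b * X) / (a * X / b) = t ^ 2 / (a ^ 2 * X ^ 2) by field_simp] at h1
  rw [show t ^ 2 * X / (a * b) * (a / (b * X)) = t ^ 2 / b ^ 2 by field_simp,
    show t ^ 2 * X / (a * b) / (a / (b * X)) = t ^ 2 * X ^ 2 / a ^ 2 by field_simp] at h2
  have hp : (ρ ^ 2) ^ 2 = ρ ^ 4 := by ring
  rw [show -(ρ ^ 2 * (t ^ 2 / a ^ 2)) * -(ρ ^ 2 * X ^ 2) = ρ ^ 4 * (t ^ 2 * X ^ 2 / a ^ 2) by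
      field_simp,
    show -(ρ ^ 2 * (t ^ 2 / a ^ 2)) / -(ρ ^ 2 * X ^ 2) = t ^ 2 / (a ^ 2 * X ^ 2) by field_simp,
    hp, show ρ ^ 4 * (ρ ^ 4 * (t ^ 2 * X ^ 2 / a ^ 2)) = (ρ ^ 4) ^ 2 * (t ^ 2 * X ^ 2 / a ^ 2) by ring,
    thetaSeries_sq_mul (pow_ne_zero _ hρ) (by positivity)] at h3
  rw [hp] at h1 h2
  rw [show (t * X / a) ^ 2 = t ^ 2 * X ^ 2 / a ^ 2 by field_simp] at h4
  rw [show (t / (a * X)) ^ 2 = t ^ 2 / (a ^ 2 * X ^ 2) by field_simp] at h5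
  rw [show (-(t / b)) ^ 2 = t ^ 2 / b ^ 2 by field_simp] at h6
  rw [mul_assoc _ (thetaSeries (ρ ^ 2) (-(ρ ^ 2 * (t ^ 2 / a ^ 2)))), h1, h2, h3, h4, h5, h6]
  field_simp
  ring

lemma theta_triple_sub₁ (hρ : ρ ≠ 0) (hρ₁ : ‖ρ‖ < 1) (ha : a ≠ 0) (hb : b ≠ 0) (hX : X ≠ 0)
    (ht : t ≠ 0) :
    theta (-(ρ ^ 2 * X / (a * b * t ^ 2))) (ρ ^ 4) * theta (-(ρ * b / t)) (ρ ^ 2) *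
        theta (-(ρ * t * X / a)) (ρ ^ 2) -
      theta (-(ρ * b * t)) (ρ ^ 2) * theta (-(ρ * X / (a * t))) (ρ ^ 2) *
        theta (-(ρ ^ 2 * t ^ 2 * X / (a * b))) (ρ ^ 4)
    = ρ * t * X / a * theta (-(a / (b * X))) (ρ ^ 4) * theta (t ^ 2)⁻¹ (ρ ^ 2) *
      theta (a * b / X) (ρ ^ 2) := by
  have hr₀ : ρ ^ 2 ≠ 0 := pow_ne_zero _ hρ
  have hr := norm_sq_lt_one hρ₁
  have hp : (ρ ^ 2) ^ 2 = ρ ^ 4 := by ring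
  have hK := qPochInf_self_ne_zero hr
  have hL := qPochInf_self_ne_zero (norm_sq_lt_one hr)
  have key := thetaSeries_triple_sub₁ hρ hρ₁ ha hb hX ht
  have e {u w : ℂ} (hu : u ≠ 0) (h : -(u / ρ) = w) :
      thetaSeries ρ w = qPochInf (ρ ^ 2) (ρ ^ 2) * theta u (ρ ^ 2) := by
    rw [qPochInf_self_mul_theta hρ hρ₁ hu, h]
  have f {u w : ℂ} (hu : u ≠ 0) (h : -(u / ρ ^ 2) = w) :
      thetaSeries (ρ ^ 2) w = qPochInf ((ρ ^ 2) ^ 2) ((ρ ^ 2) ^ 2) * theta u ((ρ ^ 2) ^ 2) := by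
    rw [qPochInf_self_mul_theta hr₀ hr hu, h]
  rw [f (u := -(ρ ^ 2 * X / (a * b * t ^ 2))) (neg_ne_zero.2 (by positivity)) (by field_simp),
    e (u := -(ρ * b / t)) (neg_ne_zero.2 (by positivity)) (by field_simp),
    e (u := -(ρ * t * X / a)) (neg_ne_zero.2 (by positivity)) (by field_simp),
    e (u := -(ρ * b * t)) (neg_ne_zero.2 (by positivity)) (by field_simp),
    e (u := -(ρ * X / (a * t))) (neg_ne_zero.2 (by positivity)) (by field_simp),
    f (u := -(ρ ^ 2 * t ^ 2 * X / (a * b))) (neg_ne_zero.2 (by positivity)) (by field_simp),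
    f (u := (ρ ^ 2) ^ 2 / (-(a / (b * X)))) (div_ne_zero (by positivity)
      (neg_ne_zero.2 (by positivity))) (by field_simp),
    e (u := ρ ^ 2 / t ^ 2) (by positivity) (by field_simp),
    e (u := ρ ^ 2 / (a * b / X)⁻¹) (by positivity) (by field_simp),
    theta_div (pow_ne_zero _ hr₀), theta_div hr₀, theta_div hr₀, ← inv_inv (t ^ 2),
    theta_inv hρ hρ₁ (u := (t ^ 2)⁻¹) (by positivity), theta_inv hρ hρ₁ (u := a * b / X) (by positivity),
    hp, inv_inv] at key
  rw [hp] at hL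
  apply mul_left_cancel₀ (mul_ne_zero hL (mul_ne_zero hK hK))
  calc _ = _ := by ring
    _ = _ := key
    _ = _ := by field_simp

lemma theta_triple_sub₂ (hρ : ρ ≠ 0) (hρ₁ : ‖ρ‖ < 1) (ha : a ≠ 0) (hb : b ≠ 0) (hX : X ≠ 0)
    (ht : t ≠ 0) :
    theta (-(ρ ^ 2 * t ^ 2 / (a * b * X))) (ρ ^ 4) * theta (-(ρ ^ 2 * a * X / b)) (ρ ^ 4) *
        theta (-(ρ * t * X / a)) (ρ ^ 2) -
      theta (-(ρ ^ 2 * t ^ 2 * X / (a * b))) (ρ ^ 4) * theta (-(ρ ^ 2 * a / (b * X))) (ρ ^ 4) *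
        theta (-(ρ * t / (a * X))) (ρ ^ 2)
    = -(ρ * t / (a * X)) * theta (ρ * b / t) (ρ ^ 2) * theta (a ^ 2 / t ^ 2) (ρ ^ 4) *
      theta (X ^ 2) (ρ ^ 4) := by
  have hr₀ : ρ ^ 2 ≠ 0 := pow_ne_zero _ hρ
  have hr := norm_sq_lt_one hρ₁
  have hp : (ρ ^ 2) ^ 2 = ρ ^ 4 := by ring
  have hK := qPochInf_self_ne_zero hr
  have hL := qPochInf_self_ne_zero (norm_sq_lt_one hr)
  have key := thetaSeries_triple_sub₂ hρ hρ₁ ha hb hX ht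
  have e {u w : ℂ} (hu : u ≠ 0) (h : -(u / ρ) = w) :
      thetaSeries ρ w = qPochInf (ρ ^ 2) (ρ ^ 2) * theta u (ρ ^ 2) := by
    rw [qPochInf_self_mul_theta hρ hρ₁ hu, h]
  have f {u w : ℂ} (hu : u ≠ 0) (h : -(u / ρ ^ 2) = w) :
      thetaSeries (ρ ^ 2) w = qPochInf ((ρ ^ 2) ^ 2) ((ρ ^ 2) ^ 2) * theta u ((ρ ^ 2) ^ 2) := by
    rw [qPochInf_self_mul_theta hr₀ hr hu, h]
  rw [f (u := -(ρ ^ 2 * t ^ 2 / (a * b * X))) (neg_ne_zero.2 (by positivity)) (by field_simp),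
    f (u := -(ρ ^ 2 * a * X / b)) (neg_ne_zero.2 (by positivity)) (by field_simp),
    e (u := -(ρ * t * X / a)) (neg_ne_zero.2 (by positivity)) (by field_simp),
    f (u := -(ρ ^ 2 * t ^ 2 * X / (a * b))) (neg_ne_zero.2 (by positivity)) (by field_simp),
    f (u := -(ρ ^ 2 * a / (b * X))) (neg_ne_zero.2 (by positivity)) (by field_simp),
    e (u := -(ρ * t / (a * X))) (neg_ne_zero.2 (by positivity)) (by field_simp),
    e (u := ρ ^ 2 / (ρ * b / t)) (by positivity) (by field_simp),
    f (u := (ρ ^ 2) ^ 2 / (a ^ 2 / t ^ 2)) (by positivity) (by field_simp),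
    f (u := (ρ ^ 2) ^ 2 / (X ^ 2)⁻¹) (by positivity) (by field_simp),
    theta_div (pow_ne_zero _ hr₀), theta_div hr₀, theta_div (pow_ne_zero _ hr₀),
    theta_inv hr₀ hr (u := X ^ 2) (by positivity), hp] at key
  rw [hp] at hL
  apply mul_left_cancel₀ (mul_ne_zero (mul_ne_zero hL hL) hK)
  calc _ = _ := by ring
    _ = _ := key
    _ = _ := by field_simp

end TripleProducts

/-- Reduction of the difference identity for the c-functions to two three-term relations between
products of theta functions. -/
lemma quotient_sub_eq_of_three_term {K : Type*} [Field K]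
    {w w' n₁ n₂ h₁ h₂ n₄ τ m₁ d₂ f₁ f₂ g₁ g₂ g₃ m₂ m₃ m₄ x₂ X k₁ k₂ l₁ l₂ l₃ e e' : K}
    (hw : w ≠ 0) (hw' : w' ≠ 0) (hn₂ : n₂ ≠ 0) (hτ : τ ≠ 0) (hm₁ : m₁ ≠ 0) (hd₂ : d₂ ≠ 0)
    (hx₂ : x₂ ≠ 0) (_ : X ≠ 0) (hf₁ : f₁ ≠ 0) (hg₁ : g₁ ≠ 0) (hm₃ : m₃ ≠ 0) (hk₁ : k₁ ≠ 0)
    (hk₂ : k₂ ≠ 0) (hm₂ : m₂ ≠ 0) (hl₁ : l₁ ≠ 0) (he : e = e' * X ^ 2)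
    (h : n₄ * h₂ * l₁ - m₂ * l₂ * m₃ = e * g₂ * τ * f₂)
    (h' : m₄ * d₂ * l₁ - m₃ * g₃ * l₃ = -e' * h₁ * n₁ * x₂) :
    (n₁ * n₂ * (h₁ * h₂) * n₄ / (w * (τ * (n₂ * m₁) * d₂)) -
        f₂ * g₂ * m₄ / (w * (-((X ^ 2)⁻¹ * x₂) * m₁))) / (f₁ * g₁ * m₃ / (w' * (x₂ * m₁))) =
      (n₁ * h₁ * l₂ / (w * (τ * k₂)) -
        f₂ * (g₂ * g₃) * k₁ * l₃ / (w * (-((X ^ 2)⁻¹ * (x₂ * (k₁ * k₂))) * m₂))) /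
        (f₁ * (g₁ * d₂) * k₁ * l₁ / (w' * (x₂ * (k₁ * k₂) * m₂))) := by
  subst he
  field_simp
  -- The right-hand sides of `h` and `h'`, weighted this way, are opposite because `e = e' * X ^ 2`.
  linear_combination n₁ * h₁ * x₂ * h + X ^ 2 * f₂ * τ * g₂ * h'

/-! ### The four c-functions in the variables `ρ, a, b, X, t` -/

section Specializations

variable {q s κ lam : ℝ}

lemma qpow_ne_zero (q : ℝ) (x : ℂ) : qpow q x ≠ 0 := Complex.exp_ne_zero _

lemma qpow_add (q : ℝ) (x y : ℂ) : qpow q (x + y) = qpow q x * qpow q y := by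
  rw [qpow, add_mul, Complex.exp_add]; rfl

lemma qpow_neg (q : ℝ) (x : ℂ) : qpow q (-x) = (qpow q x)⁻¹ := by
  rw [qpow, neg_mul, Complex.exp_neg]; rfl

lemma qpow_sub (q : ℝ) (x y : ℂ) : qpow q (x - y) = qpow q x / qpow q y := by
  rw [sub_eq_add_neg, qpow_add, qpow_neg, div_eq_mul_inv]

lemma qpow_nat_mul (q : ℝ) (n : ℕ) (x : ℂ) : qpow q (n * x) = qpow q x ^ n := by
  rw [qpow, mul_assoc, Complex.exp_nat_mul]; rfl

lemma norm_qpow_lt_one (hq₀ : 0 < q) (hq₁ : q < 1) {r : ℝ} (hr : 0 < r) : ‖qpow q r‖ < 1 := by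
  rw [qpow, Complex.norm_exp, ← Complex.ofReal_mul, Complex.ofReal_re]
  simpa using Real.exp_lt_exp.2 (mul_neg_of_pos_of_neg hr (Real.log_neg hq₀ hq₁))

lemma qpow_eq_sq (q : ℝ) (x : ℂ) : qpow q x = qpow q (x / 2) ^ 2 := by
  rw [← qpow_nat_mul]; congr 1; push_cast; ring

lemma qpow_half_eq (q s : ℝ) : qpow q ((s : ℂ) / 2) = qpow q ((s / 4 : ℝ) : ℂ) ^ 2 := by
  rw [← qpow_nat_mul]; congr 1; push_cast; ring

lemma qpow_eq_pow_four (q s : ℝ) : qpow q (s : ℂ) = qpow q ((s / 4 : ℝ) : ℂ) ^ 4 := by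
  rw [← qpow_nat_mul]; congr 1; push_cast; ring

variable {ρ a b X t x z : ℂ}

/-- The quarter step `ρ` makes both nomes and all half-steps integral powers of `ρ`. The prefactor
is written in the form shared by all four specializations: halving `z` and `s` together preserves
the exponent of `W`. -/
lemma specJ_apply (hρ : qpow q ((s / 4 : ℝ) : ℂ) = ρ) (ha : qpow q κ = a) (hb : qpow q lam = b)
    (hX : qpow q x = X) (ht : qpow q (z / 2) = t) :
    specJ cNum κ lam q s x z = theta (a ^ 2 / t ^ 2) (ρ ^ 4) * theta (-(t ^ 2)⁻¹) (ρ ^ 4) *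
        theta (ρ ^ 2 * b ^ 2 / t ^ 2) (ρ ^ 4) * theta (-(ρ ^ 2 * X / (a * b * t ^ 2))) (ρ ^ 4) ∧
    specJ cDen κ lam q s x z = qpow q ((κ + lam + x) * (κ + κ + z) / s) *
      (theta ((t ^ 2) ^ 2)⁻¹ (ρ ^ 4) * theta (-(ρ ^ 2 * a * X / b)) (ρ ^ 4)) := by
  have ha₀ : a ≠ 0 := ha ▸ qpow_ne_zero _ _
  have hb₀ : b ≠ 0 := hb ▸ qpow_ne_zero _ _
  have ht₀ : t ≠ 0 := ht ▸ qpow_ne_zero _ _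
  have hz : qpow q z = t ^ 2 := by rw [qpow_eq_sq, ht]
  have h2 : qpow q (-2 * z) = ((t ^ 2) ^ 2)⁻¹ := by
    rw [← hz, ← qpow_nat_mul, ← qpow_neg]; congr 1; push_cast; ring
  simp only [specJ, cNum, cDen, W, aDual, bDual, cDual, dParam, qpow_add, qpow_sub, qpow_neg,
    qpow_half_eq, qpow_eq_pow_four q s, hρ, ha, hb, hX, hz, h2]
  refine ⟨?_, ?_⟩
  · congr 1
    · congr 1
      · congr 1
        · congr 1; field_simp
        · congr 1; field_simp
      · congr 1; field_simp
    · congr 1; field_simp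
  · congr 1
    congr 2; field_simp

lemma specJDual_apply (hρ : qpow q ((s / 4 : ℝ) : ℂ) = ρ) (ha : qpow q κ = a)
    (hb : qpow q lam = b) (hX : qpow q x = X) (ht : qpow q (z / 2) = t) :
    specJDual cNum κ lam q s z x = theta (a * b / X) (ρ ^ 4) * theta (-(a / (b * X))) (ρ ^ 4) *
        theta (a * b / X * ρ ^ 2) (ρ ^ 4) * theta (-(ρ ^ 2 * t ^ 2 / (a * b * X))) (ρ ^ 4) ∧
    specJDual cDen κ lam q s z x = qpow q ((κ + lam + x) * (κ + κ + z) / s) *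
      (theta (X ^ 2)⁻¹ (ρ ^ 4) * theta (-(ρ ^ 2 * t ^ 2)) (ρ ^ 4)) := by
  have ha₀ : a ≠ 0 := ha ▸ qpow_ne_zero _ _
  have hb₀ : b ≠ 0 := hb ▸ qpow_ne_zero _ _
  have hX₀ : X ≠ 0 := hX ▸ qpow_ne_zero _ _
  have hz : qpow q z = t ^ 2 := by rw [qpow_eq_sq, ht]
  have h2 : qpow q (-2 * x) = (X ^ 2)⁻¹ := by
    rw [← hX, ← qpow_nat_mul, ← qpow_neg]; congr 1; push_cast; ring
  simp only [specJDual, cNum, cDen, W, aDual, bDual, cDual, dParam, qpow_add, qpow_sub, qpow_neg,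
    qpow_half_eq, qpow_eq_pow_four q s, hρ, ha, hb, hX, hz, h2]
  refine ⟨?_, ?_⟩
  · congr 1
    · congr 1
      · congr 1
        congr 1; field_simp
      · congr 1; field_simp
    · congr 1; field_simp
  · congr 1
    · congr 1; ring
    · congr 2; field_simp

lemma specR_apply (hρ : qpow q ((s / 4 : ℝ) : ℂ) = ρ) (ha : qpow q κ = a) (hb : qpow q lam = b)
    (hX : qpow q x = X) (ht : qpow q (z / 2) = t) :
    specR cNum κ lam q s x z = theta (a / t) (ρ ^ 2) * theta (-(a / t)) (ρ ^ 2) *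
        theta (ρ * b / t) (ρ ^ 2) * theta (-(ρ * X / (a * t))) (ρ ^ 2) ∧
    specR cDen κ lam q s x z = qpow q ((κ + lam + x) * (κ + κ + z) / s) *
      (theta (t ^ 2)⁻¹ (ρ ^ 2) * theta (-(ρ * X)) (ρ ^ 2)) := by
  have ha₀ : a ≠ 0 := ha ▸ qpow_ne_zero _ _
  have ht₀ : t ≠ 0 := ht ▸ qpow_ne_zero _ _
  have hr : qpow q ((s / 2 : ℝ) : ℂ) = ρ ^ 2 := by rw [← hρ, ← qpow_half_eq]; push_cast; rfl
  have hρ' : qpow q (((s / 2 : ℝ) : ℂ) / 2) = ρ := by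
    rw [← hρ]; congr 1; push_cast; ring
  have h2 : qpow q (-2 * (z / 2)) = (t ^ 2)⁻¹ := by
    rw [← ht, ← qpow_nat_mul, ← qpow_neg]; congr 1; push_cast; ring
  simp only [specR, cNum, cDen, W, aDual, bDual, cDual, dParam, qpow_add, qpow_sub, qpow_neg, hr,
    hρ', Complex.ofReal_zero, add_zero, sub_zero, ha, hb, hX, ht, h2]
  refine ⟨?_, ?_⟩
  · congr 1
    · congr 2; field_simp
    · congr 1; field_simp
  · congr 1
    · congr 1; push_cast; ring
    · congr 2; ring

/-- Tying `y` to `2 * x` by an equation lets the same formula serve at `-2 * x`, with `-x` for `x`.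
-/
lemma specRDual_apply (hρ : qpow q ((s / 4 : ℝ) : ℂ) = ρ) (ha : qpow q κ = a)
    (hb : qpow q lam = b) (hX : qpow q x = X) (ht : qpow q (z / 2) = t) {y : ℂ} (hy : y = 2 * x) :
    specRDual cNum κ lam q s (z / 2) y =
        theta (a * b / X) (ρ ^ 2) * theta (-(a / (b * X))) (ρ ^ 2) *
        theta (ρ / X) (ρ ^ 2) * theta (-(ρ * t / (a * X))) (ρ ^ 2) ∧
    specRDual cDen κ lam q s (z / 2) y = qpow q ((κ + lam + x) * (κ + κ + z) / s) *
      (theta (X ^ 2)⁻¹ (ρ ^ 2) * theta (-(ρ * b * t)) (ρ ^ 2)) := by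
  have ha₀ : a ≠ 0 := ha ▸ qpow_ne_zero _ _
  have hb₀ : b ≠ 0 := hb ▸ qpow_ne_zero _ _
  have hX₀ : X ≠ 0 := hX ▸ qpow_ne_zero _ _
  have hyx : y / 2 = x := by rw [hy]; ring
  have hr : qpow q ((s / 2 : ℝ) : ℂ) = ρ ^ 2 := by rw [← hρ, ← qpow_half_eq]; push_cast; rfl
  have hρ' : qpow q (((s / 2 : ℝ) : ℂ) / 2) = ρ := by
    rw [← hρ]; congr 1; push_cast; ring
  have h2 : qpow q (-2 * x) = (X ^ 2)⁻¹ := by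
    rw [← hX, ← qpow_nat_mul, ← qpow_neg]; congr 1; push_cast; ring
  simp only [specRDual, cNum, cDen, W, aDual, bDual, cDual, dParam, qpow_add, qpow_sub, qpow_neg,
    hr, hρ', hyx, Complex.ofReal_zero, add_zero, sub_zero, ha, hb, hX, ht, h2]
  refine ⟨?_, ?_⟩
  · congr 1
    · congr 2
      congr 1; field_simp
    · congr 1; field_simp
  · congr 1
    · congr 1; push_cast; ring
    · congr 2; ring

end Specializations

/-! ### Duplication formulas in nomes `ρ ^ 2` and `ρ ^ 4` -/

section ThetaDuplication

variable {ρ a b X t : ℂ}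

/-- Duplication is applied twice: first to the square, then to the factor with the minus sign, whose
second part is reflected by `u ↦ p / u`. -/
lemma theta_inv_sq_sq (hρ : ρ ≠ 0) (hρ₁ : ‖ρ‖ < 1) (ht : t ≠ 0) :
    theta ((t ^ 2) ^ 2)⁻¹ (ρ ^ 4) = theta (t ^ 2)⁻¹ (ρ ^ 2) *
      (theta (-(t ^ 2)⁻¹) (ρ ^ 4) * theta (-(ρ ^ 2 * t ^ 2)) (ρ ^ 4)) := by
  have hr₀ : ρ ^ 2 ≠ 0 := pow_ne_zero _ hρ
  have hr := norm_sq_lt_one hρ₁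
  have hp : (ρ ^ 2) ^ 2 = ρ ^ 4 := by ring
  have h1 := theta_mul_neg hr (t ^ 2)⁻¹
  rw [theta_eq_mul_sq hr₀ hr (u := -(t ^ 2)⁻¹) (neg_ne_zero.2 (by positivity)),
    ← theta_div (u := -(t ^ 2)⁻¹ * ρ ^ 2) (pow_ne_zero 2 hr₀), hp, inv_pow,
    show ρ ^ 4 / (-(t ^ 2)⁻¹ * ρ ^ 2) = -(ρ ^ 2 * t ^ 2) by field_simp] at h1
  exact h1.symm

lemma theta_sq_eq (hρ : ρ ≠ 0) (hρ₁ : ‖ρ‖ < 1) (hX : X ≠ 0) :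
    theta (X ^ 2) (ρ ^ 2) =
      theta (X ^ 2) (ρ ^ 4) * (theta (ρ * X) (ρ ^ 2) * theta (-(ρ * X)) (ρ ^ 2)) := by
  have hr₀ : ρ ^ 2 ≠ 0 := pow_ne_zero _ hρ
  have hr := norm_sq_lt_one hρ₁
  rw [theta_eq_mul_sq hr₀ hr (u := X ^ 2) (by positivity), theta_mul_neg hr]
  ring_nf

lemma theta_eq_mul_pow_four {u : ℂ} (hρ : ρ ≠ 0) (hρ₁ : ‖ρ‖ < 1) (hu : u ≠ 0) :
    theta u (ρ ^ 2) = theta u (ρ ^ 4) * theta (u * ρ ^ 2) (ρ ^ 4) := by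
  rw [theta_eq_mul_sq (pow_ne_zero _ hρ) (norm_sq_lt_one hρ₁) hu]
  ring_nf

lemma theta_sq_mul_neg {u : ℂ} (hρ₁ : ‖ρ‖ < 1) :
    theta (u ^ 2) (ρ ^ 4) = theta u (ρ ^ 2) * theta (-u) (ρ ^ 2) := by
  rw [theta_mul_neg (norm_sq_lt_one hρ₁)]
  ring_nf

end ThetaDuplication

/-! ### Factored c-functions and the two identities -/

section Identities

variable {q s κ lam : ℝ} {ρ a b X t x z : ℂ}

lemma specJ_eq (hρ₀ : ρ ≠ 0) (hρ₁ : ‖ρ‖ < 1) (hρ : qpow q ((s / 4 : ℝ) : ℂ) = ρ)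
    (ha : qpow q κ = a) (hb : qpow q lam = b) (hX : qpow q x = X) (ht : qpow q (z / 2) = t) :
    specJ cNum κ lam q s x z = theta (a ^ 2 / t ^ 2) (ρ ^ 4) * theta (-(t ^ 2)⁻¹) (ρ ^ 4) *
        (theta (ρ * b / t) (ρ ^ 2) * theta (-(ρ * b / t)) (ρ ^ 2)) *
        theta (-(ρ ^ 2 * X / (a * b * t ^ 2))) (ρ ^ 4) ∧
    specJ cDen κ lam q s x z = qpow q ((κ + lam + x) * (κ + κ + z) / s) *
      (theta (t ^ 2)⁻¹ (ρ ^ 2) *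
        (theta (-(t ^ 2)⁻¹) (ρ ^ 4) * theta (-(ρ ^ 2 * t ^ 2)) (ρ ^ 4)) *
          theta (-(ρ ^ 2 * a * X / b)) (ρ ^ 4)) := by
  obtain ⟨h1, h2⟩ := specJ_apply hρ ha hb hX ht
  rw [h1, h2, theta_inv_sq_sq hρ₀ hρ₁ (ht ▸ qpow_ne_zero _ _), ← theta_sq_mul_neg hρ₁]
  refine ⟨?_, rfl⟩
  congr 4
  ring

lemma specJDual_eq (hρ₀ : ρ ≠ 0) (hρ₁ : ‖ρ‖ < 1) (hρ : qpow q ((s / 4 : ℝ) : ℂ) = ρ)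
    (ha : qpow q κ = a) (hb : qpow q lam = b) (hX : qpow q x = X) (ht : qpow q (z / 2) = t) :
    specJDual cNum κ lam q s z x = theta (a * b / X) (ρ ^ 2) * theta (-(a / (b * X))) (ρ ^ 4) *
        theta (-(ρ ^ 2 * t ^ 2 / (a * b * X))) (ρ ^ 4) ∧
    specJDual cDen κ lam q s z x = qpow q ((κ + lam + x) * (κ + κ + z) / s) *
      (theta (X ^ 2)⁻¹ (ρ ^ 4) * theta (-(ρ ^ 2 * t ^ 2)) (ρ ^ 4)) := by
  obtain ⟨h1, h2⟩ := specJDual_apply hρ ha hb hX ht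
  have ha₀ : a ≠ 0 := ha ▸ qpow_ne_zero _ _
  have hb₀ : b ≠ 0 := hb ▸ qpow_ne_zero _ _
  have hX₀ : X ≠ 0 := hX ▸ qpow_ne_zero _ _
  rw [h1, h2, theta_eq_mul_pow_four hρ₀ hρ₁ (u := a * b / X) (by positivity)]
  exact ⟨by ring, rfl⟩

lemma specR_eq (hρ₁ : ‖ρ‖ < 1) (hρ : qpow q ((s / 4 : ℝ) : ℂ) = ρ)
    (ha : qpow q κ = a) (hb : qpow q lam = b) (hX : qpow q x = X) (ht : qpow q (z / 2) = t) :
    specR cNum κ lam q s x z = theta (a ^ 2 / t ^ 2) (ρ ^ 4) *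
        theta (ρ * b / t) (ρ ^ 2) * theta (-(ρ * X / (a * t))) (ρ ^ 2) ∧
    specR cDen κ lam q s x z = qpow q ((κ + lam + x) * (κ + κ + z) / s) *
      (theta (t ^ 2)⁻¹ (ρ ^ 2) * theta (-(ρ * X)) (ρ ^ 2)) := by
  obtain ⟨h1, h2⟩ := specR_apply hρ ha hb hX ht
  rw [h1, h2, ← theta_sq_mul_neg hρ₁, div_pow]
  exact ⟨rfl, rfl⟩

lemma specRDual_eq (hρ₀ : ρ ≠ 0) (hρ₁ : ‖ρ‖ < 1) (hρ : qpow q ((s / 4 : ℝ) : ℂ) = ρ)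
    (ha : qpow q κ = a) (hb : qpow q lam = b) (hX : qpow q x = X) (ht : qpow q (z / 2) = t)
    {y : ℂ} (hy : y = 2 * x) :
    specRDual cNum κ lam q s (z / 2) y = theta (a * b / X) (ρ ^ 2) *
        (theta (-(a / (b * X))) (ρ ^ 4) * theta (-(ρ ^ 2 * a / (b * X))) (ρ ^ 4)) *
        theta (ρ * X) (ρ ^ 2) * theta (-(ρ * t / (a * X))) (ρ ^ 2) ∧
    specRDual cDen κ lam q s (z / 2) y = qpow q ((κ + lam + x) * (κ + κ + z) / s) *
      (theta (X ^ 2)⁻¹ (ρ ^ 2) * theta (-(ρ * b * t)) (ρ ^ 2)) := by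
  obtain ⟨h1, h2⟩ := specRDual_apply hρ ha hb hX ht hy
  have ha₀ : a ≠ 0 := ha ▸ qpow_ne_zero _ _
  have hb₀ : b ≠ 0 := hb ▸ qpow_ne_zero _ _
  have hX₀ : X ≠ 0 := hX ▸ qpow_ne_zero _ _
  rw [h1, h2, theta_eq_mul_pow_four hρ₀ hρ₁ (u := -(a / (b * X))) (neg_ne_zero.2 (by positivity)),
    show ρ / X = ρ ^ 2 / (ρ * X) by field_simp, theta_div (pow_ne_zero _ hρ₀),
    show -(a / (b * X)) * ρ ^ 2 = -(ρ ^ 2 * a / (b * X)) by ring]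
  exact ⟨rfl, rfl⟩

lemma specJDual_neg_eq (hρ₀ : ρ ≠ 0) (hρ₁ : ‖ρ‖ < 1) (hρ : qpow q ((s / 4 : ℝ) : ℂ) = ρ)
    (ha : qpow q κ = a) (hb : qpow q lam = b) (hX : qpow q x = X) (ht : qpow q (z / 2) = t) :
    specJDual cNum κ lam q s z (-x) = theta (a * b * X) (ρ ^ 2) * theta (-(a * X / b)) (ρ ^ 4) *
        theta (-(ρ ^ 2 * t ^ 2 * X / (a * b))) (ρ ^ 4) ∧
    specJDual cDen κ lam q s z (-x) = qpow q ((κ + lam - x) * (κ + κ + z) / s) *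
      (theta (X ^ 2) (ρ ^ 4) * theta (-(ρ ^ 2 * t ^ 2)) (ρ ^ 4)) := by
  have hX' : qpow q (-x) = X⁻¹ := by rw [qpow_neg, hX]
  obtain ⟨h1, h2⟩ := specJDual_eq hρ₀ hρ₁ hρ ha hb hX' ht
  have hX₀ : X ≠ 0 := hX ▸ qpow_ne_zero _ _
  rw [h1, h2, div_inv_eq_mul, show a / (b * X⁻¹) = a * X / b by field_simp,
    show ρ ^ 2 * t ^ 2 / (a * b * X⁻¹) = ρ ^ 2 * t ^ 2 * X / (a * b) by field_simp, inv_pow, inv_inv,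
    ← sub_eq_add_neg]
  exact ⟨rfl, rfl⟩

lemma specRDual_neg_eq (hρ₀ : ρ ≠ 0) (hρ₁ : ‖ρ‖ < 1) (hρ : qpow q ((s / 4 : ℝ) : ℂ) = ρ)
    (ha : qpow q κ = a) (hb : qpow q lam = b) (hX : qpow q x = X) (ht : qpow q (z / 2) = t) :
    specRDual cNum κ lam q s (z / 2) (-2 * x) = theta (a * b * X) (ρ ^ 2) *
        (theta (-(a * X / b)) (ρ ^ 4) * theta (-(ρ ^ 2 * a * X / b)) (ρ ^ 4)) *
        theta (ρ * X) (ρ ^ 2) * theta (-(ρ * t * X / a)) (ρ ^ 2) ∧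
    specRDual cDen κ lam q s (z / 2) (-2 * x) = qpow q ((κ + lam - x) * (κ + κ + z) / s) *
      (theta (X ^ 2) (ρ ^ 4) * (theta (ρ * X) (ρ ^ 2) * theta (-(ρ * X)) (ρ ^ 2)) *
        theta (-(ρ * b * t)) (ρ ^ 2)) := by
  have hX' : qpow q (-x) = X⁻¹ := by rw [qpow_neg, hX]
  obtain ⟨h1, h2⟩ := specRDual_eq hρ₀ hρ₁ hρ ha hb hX' ht (show -2 * x = 2 * -x by ring)
  have hX₀ : X ≠ 0 := hX ▸ qpow_ne_zero _ _
  rw [h1, h2, div_inv_eq_mul, show a / (b * X⁻¹) = a * X / b by field_simp,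
    show ρ ^ 2 * a / (b * X⁻¹) = ρ ^ 2 * a * X / b by field_simp,
    show ρ * X⁻¹ = ρ ^ 2 / (ρ * X) by field_simp, theta_div (pow_ne_zero _ hρ₀),
    show ρ * t / (a * X⁻¹) = ρ * t * X / a by field_simp, inv_pow, inv_inv, ← sub_eq_add_neg,
    theta_sq_eq hρ₀ hρ₁ hX₀]
  exact ⟨rfl, rfl⟩

lemma specJ_cFun : specJ cFun κ lam q s x z = specJ cNum κ lam q s x z / specJ cDen κ lam q s x z :=
  rfl

lemma specJDual_cFun :
    specJDual cFun κ lam q s x z = specJDual cNum κ lam q s x z / specJDual cDen κ lam q s x z :=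
  rfl

lemma specR_cFun : specR cFun κ lam q s x z = specR cNum κ lam q s x z / specR cDen κ lam q s x z :=
  rfl

lemma specRDual_cFun :
    specRDual cFun κ lam q s x z = specRDual cNum κ lam q s x z / specRDual cDen κ lam q s x z :=
  rfl

theorem cFun_quotient_eq (hq₀ : 0 < q) (hq₁ : q < 1) (hs : 0 < s)
    (h : (x, z) ∈ domain₁ κ lam q s) :
    specJ cFun κ lam q s x (-z) / specJDual cFun κ lam q s z (-x) =
      specR cFun κ lam q s x (-z) / specRDual cFun κ lam q s (z / 2) (-2 * x) := by
  obtain ⟨h1, h2, h3, h4, h5, h6⟩ := h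
  dsimp only at h1 h2 h3 h4 h5 h6
  obtain ⟨ρ, hρ⟩ : ∃ ρ, qpow q ((s / 4 : ℝ) : ℂ) = ρ := ⟨_, rfl⟩
  obtain ⟨a, ha⟩ : ∃ a, qpow q κ = a := ⟨_, rfl⟩
  obtain ⟨b, hb⟩ : ∃ b, qpow q lam = b := ⟨_, rfl⟩
  obtain ⟨X, hX⟩ : ∃ X, qpow q x = X := ⟨_, rfl⟩
  obtain ⟨t, ht⟩ : ∃ t, qpow q (z / 2) = t := ⟨_, rfl⟩
  have ha₀ : a ≠ 0 := ha ▸ qpow_ne_zero _ _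
  have hb₀ : b ≠ 0 := hb ▸ qpow_ne_zero _ _
  have hX₀ : X ≠ 0 := hX ▸ qpow_ne_zero _ _
  have ht₀ : t ≠ 0 := ht ▸ qpow_ne_zero _ _
  have hρ₀ : ρ ≠ 0 := hρ ▸ qpow_ne_zero _ _
  have hρ₁ : ‖ρ‖ < 1 := hρ ▸ norm_qpow_lt_one hq₀ hq₁ (by positivity)
  obtain ⟨D₁, D₂⟩ := specJDual_neg_eq hρ₀ hρ₁ hρ ha hb hX ht
  obtain ⟨S₁, S₂⟩ := specRDual_neg_eq hρ₀ hρ₁ hρ ha hb hX ht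
  have ht' : qpow q (-z / 2) = t⁻¹ := by rw [neg_div, qpow_neg, ht]
  obtain ⟨J₁, J₂⟩ := specJ_eq hρ₀ hρ₁ hρ ha hb hX ht'
  obtain ⟨R₁, R₂⟩ := specR_eq hρ₁ hρ ha hb hX ht'
  -- The reflection `u ↦ p / u` identifies this factor with the one in the denominator of the dual
  -- function.
  rw [inv_pow, inv_inv, show -(ρ ^ 2 * (t ^ 2)⁻¹) = ρ ^ 4 / (-(ρ ^ 2 * t ^ 2)) by field_simp,
    theta_div (pow_ne_zero _ hρ₀)] at J₂
  rw [inv_pow, inv_inv] at R₂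
  rw [inv_pow, inv_inv, div_inv_eq_mul, div_inv_eq_mul,
    show ρ ^ 2 * X / (a * b * (t ^ 2)⁻¹) = ρ ^ 2 * t ^ 2 * X / (a * b) by field_simp] at J₁
  rw [inv_pow, div_inv_eq_mul, div_inv_eq_mul,
    show ρ * X / (a * t⁻¹) = ρ * t * X / a by field_simp] at R₁
  simp only [specJ_cFun, specJDual_cFun, specR_cFun, specRDual_cFun] at *
  simp only [J₁, J₂, R₁, R₂, D₁, D₂, S₁, S₂, mul_ne_zero_iff, div_ne_zero_iff] at *
  obtain ⟨hw, ⟨hτ, hn₂, hm₁⟩, hd₂⟩ := h1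
  obtain ⟨⟨⟨hf₁, hg₁⟩, hm₃⟩, hw', hx₂, -⟩ := h3
  obtain ⟨⟨⟨-, hk₁⟩, hl₁⟩, -, ⟨-, -, hk₂⟩, hm₂⟩ := h6
  generalize theta (-(ρ ^ 2 * t ^ 2 * X / (a * b))) (ρ ^ 4) = m₃ at *
  -- With these theta values as atoms, the identity is a cancellation of monomials.
  generalize theta (-(ρ ^ 2 * t ^ 2)) (ρ ^ 4) = m₁ at *
  generalize theta (-(ρ ^ 2 * a * X / b)) (ρ ^ 4) = d₂ at *
  generalize theta (-(ρ * t * X / a)) (ρ ^ 2) = l₁ at *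
  generalize theta (-(ρ * b * t)) (ρ ^ 2) = m₂ at *
  field_simp

theorem cFun_quotient_sub_eq (hq₀ : 0 < q) (hq₁ : q < 1) (hs : 0 < s)
    (h : (x, z) ∈ domain₂ κ lam q s) :
    (specJ cFun κ lam q s x z - specJDual cFun κ lam q s z x) / specJDual cFun κ lam q s z (-x) =
      (specR cFun κ lam q s x z - specRDual cFun κ lam q s (z / 2) (2 * x)) /
        specRDual cFun κ lam q s (z / 2) (-2 * x) := by
  obtain ⟨h1, h2, h3, h4, h5, h6, h7, h8⟩ := h
  dsimp only at h1 h2 h3 h4 h5 h6 h7 h8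
  obtain ⟨ρ, hρ⟩ : ∃ ρ, qpow q ((s / 4 : ℝ) : ℂ) = ρ := ⟨_, rfl⟩
  obtain ⟨a, ha⟩ : ∃ a, qpow q κ = a := ⟨_, rfl⟩
  obtain ⟨b, hb⟩ : ∃ b, qpow q lam = b := ⟨_, rfl⟩
  obtain ⟨X, hX⟩ : ∃ X, qpow q x = X := ⟨_, rfl⟩
  obtain ⟨t, ht⟩ : ∃ t, qpow q (z / 2) = t := ⟨_, rfl⟩
  have ha₀ : a ≠ 0 := ha ▸ qpow_ne_zero _ _
  have hb₀ : b ≠ 0 := hb ▸ qpow_ne_zero _ _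
  have hX₀ : X ≠ 0 := hX ▸ qpow_ne_zero _ _
  have ht₀ : t ≠ 0 := ht ▸ qpow_ne_zero _ _
  have hρ₀ : ρ ≠ 0 := hρ ▸ qpow_ne_zero _ _
  have hρ₁ : ‖ρ‖ < 1 := hρ ▸ norm_qpow_lt_one hq₀ hq₁ (by positivity)
  obtain ⟨D₁, D₂⟩ := specJDual_neg_eq hρ₀ hρ₁ hρ ha hb hX ht
  obtain ⟨S₁, S₂⟩ := specRDual_neg_eq hρ₀ hρ₁ hρ ha hb hX ht
  have hr₀ : ρ ^ 2 ≠ 0 := pow_ne_zero _ hρ₀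
  have hr := norm_sq_lt_one hρ₁
  obtain ⟨J₁, J₂⟩ := specJ_eq hρ₀ hρ₁ hρ ha hb hX ht
  obtain ⟨R₁, R₂⟩ := specR_eq hρ₁ hρ ha hb hX ht
  obtain ⟨E₁, E₂⟩ := specJDual_eq hρ₀ hρ₁ hρ ha hb hX ht
  obtain ⟨F₁, F₂⟩ := specRDual_eq hρ₀ hρ₁ hρ ha hb hX ht rfl
  -- Inversion brings the denominators at `x` and `-x` to the same theta values, at the cost of the
  -- factor `-X⁻²`.
  rw [theta_inv hρ₀ hρ₁ (pow_ne_zero 2 hX₀), theta_sq_eq hρ₀ hρ₁ hX₀] at F₂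
  rw [show ρ ^ 4 = (ρ ^ 2) ^ 2 by ring, theta_inv hr₀ hr (pow_ne_zero 2 hX₀),
    show (ρ ^ 2) ^ 2 = ρ ^ 4 by ring] at E₂
  simp only [specJ_cFun, specJDual_cFun, specR_cFun, specRDual_cFun] at *
  simp only [J₁, J₂, R₁, R₂, D₁, D₂, S₁, S₂, E₁, E₂, F₁, F₂, mul_ne_zero_iff, div_ne_zero_iff] at *
  obtain ⟨hw, ⟨hτ, hn₂, hm₁⟩, hd₂⟩ := h1
  obtain ⟨⟨⟨hf₁, hg₁⟩, hm₃⟩, hw', hx₂, -⟩ := h4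
  obtain ⟨⟨⟨-, hk₁⟩, hl₁⟩, -, ⟨-, -, hk₂⟩, hm₂⟩ := h8
  exact quotient_sub_eq_of_three_term hw hw' hn₂ hτ hm₁ hd₂ hx₂ hX₀ hf₁ hg₁ hm₃ hk₁ hk₂ hm₂ hl₁
    (e := ρ * t * X / a) (e' := ρ * t / (a * X)) (by field_simp)
    (theta_triple_sub₁ hρ₀ hρ₁ ha₀ hb₀ hX₀ ht₀) (theta_triple_sub₂ hρ₀ hρ₁ ha₀ hb₀ hX₀ ht₀)

end Identities

/-! ### Openness and density of the domains -/

section Density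

/-- The set where `F` does not vanish is open and dense. -/
def NonvanishingOnOpenDense (F : ℂ × ℂ → ℂ) : Prop :=
  IsOpen {v | F v ≠ 0} ∧ Dense {v | F v ≠ 0}

lemma NonvanishingOnOpenDense.mul {F G : ℂ × ℂ → ℂ} (hF : NonvanishingOnOpenDense F)
    (hG : NonvanishingOnOpenDense G) : NonvanishingOnOpenDense fun v => F v * G v := by
  have h : {v | F v * G v ≠ 0} = {v | F v ≠ 0} ∩ {v | G v ≠ 0} := by
    ext v; simp
  unfold NonvanishingOnOpenDense
  rw [h]
  exact ⟨hF.1.inter hG.1, hF.2.inter_of_isOpen_left hG.2 hF.1⟩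

lemma continuous_qPochInf {p : ℂ} (hp : ‖p‖ < 1) : Continuous fun u => qPochInf u p := by
  rw [continuous_iff_continuousAt]
  intro u
  have hK : IsOpen (Metric.ball (0 : ℂ) (‖u‖ + 1)) := Metric.isOpen_ball
  have h := Summable.hasProdLocallyUniformlyOn_nat_one_add (f := fun i w => -(w * p ^ i)) hK
    ((summable_geometric_of_lt_one (norm_nonneg _) hp).mul_left (‖u‖ + 1))
    (Eventually.of_forall fun n x hx => by
      rw [norm_neg, norm_mul, norm_pow]
      gcongr
      exact (mem_ball_zero_iff.1 hx).le)
    (fun n => by fun_prop)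
  have hc : ContinuousOn (fun u => ∏' i : ℕ, (1 + -(u * p ^ i))) (Metric.ball (0 : ℂ) (‖u‖ + 1)) :=
    h.tendstoLocallyUniformlyOn_finsetRange.continuousOn
      (Frequently.of_forall fun n => by fun_prop)
  simp only [← sub_eq_add_neg] at hc
  exact hc.continuousAt (hK.mem_nhds (by simp))

/-- A convergent product vanishes only if a factor does: the first product gives exponents `n ≤ 0`,
the second `n ≥ 1`. -/
lemma exists_zpow_eq_of_theta_eq_zero {u p : ℂ} (hp₀ : p ≠ 0) (hp : ‖p‖ < 1) (hu : u ≠ 0)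
    (h : theta u p = 0) : ∃ n : ℤ, u = p ^ n := by
  rcases mul_eq_zero.1 h with h | h
  · by_contra! hn
    refine qPochInf_ne_zero hp (fun i hi => hn (-i) ?_) h
    rw [zpow_neg, zpow_natCast]
    exact eq_inv_of_mul_eq_one_left hi
  · by_contra! hn
    refine qPochInf_ne_zero hp (fun i hi => hn (i + 1) ?_) h
    rw [zpow_add_one₀ hp₀, zpow_natCast]
    field_simp at hi
    rw [← hi, mul_comm]

lemma countable_qpow_eq {q : ℝ} (hq₀ : 0 < q) (hq₁ : q < 1) (c : ℂ) :
    {w : ℂ | qpow q w = c}.Countable := by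
  have hL : (Real.log q : ℂ) ≠ 0 := by exact_mod_cast (Real.log_neg hq₀ hq₁).ne
  rcases Set.eq_empty_or_nonempty {w : ℂ | qpow q w = c} with h | ⟨w₀, hw₀⟩
  · rw [h]; exact Set.countable_empty
  refine (Set.countable_range fun n : ℤ => w₀ + n * (2 * Real.pi * Complex.I) / (Real.log q : ℂ)).mono ?_
  intro w hw
  obtain ⟨n, hn⟩ := Complex.exp_eq_exp_iff_exists_int.1 (hw.trans hw₀.symm)
  refine ⟨n, ?_⟩
  dsimp only
  field_simp
  linear_combination -hn

/-- The zeros in the single variable `w = αx + βz` form a countable closed set, so their complement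
is open and dense in `ℂ`. A nonzero linear form is continuous and open, hence pulls this back to `ℂ
× ℂ`. -/
lemma nonvanishingOnOpenDense_theta {q : ℝ} (hq₀ : 0 < q) (hq₁ : q < 1) {p A α β : ℂ} (hp₀ : p ≠ 0)
    (hp : ‖p‖ < 1) (hA : A ≠ 0) (hαβ : α ≠ 0 ∨ β ≠ 0) {u : ℂ × ℂ → ℂ}
    (hu : ∀ v, u v = A * qpow q (α * v.1 + β * v.2)) :
    NonvanishingOnOpenDense fun v => theta (u v) p := by
  let ℓ : ℂ × ℂ →L[ℂ] ℂ := α • ContinuousLinearMap.fst ℂ ℂ ℂ + β • ContinuousLinearMap.snd ℂ ℂ ℂ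
  have hℓ : ∀ v, ℓ v = α * v.1 + β * v.2 := fun v => rfl
  have hsurj : Function.Surjective ℓ := by
    intro w
    rcases hαβ with h | h
    · exact ⟨(w / α, 0), by rw [hℓ]; simp; field_simp⟩
    · exact ⟨(0, w / β), by rw [hℓ]; simp; field_simp⟩
  have hne : ∀ w, A * qpow q w ≠ 0 := fun w => mul_ne_zero hA (qpow_ne_zero _ _)
  have hcq : Continuous fun w => A * qpow q w := by unfold qpow; fun_prop
  have hcont : Continuous fun w => theta (A * qpow q w) p :=
    ((continuous_qPochInf hp).comp hcq).mul
      ((continuous_qPochInf hp).comp (continuous_const.div hcq hne))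
  have hset : {v | theta (u v) p ≠ 0} = ℓ ⁻¹' {w | theta (A * qpow q w) p = 0}ᶜ := by
    ext v; simp [hu, hℓ]
  have hcount : {w | theta (A * qpow q w) p = 0}.Countable := by
    refine (Set.countable_iUnion fun n : ℤ => countable_qpow_eq hq₀ hq₁ (p ^ n / A)).mono ?_
    intro w hw
    obtain ⟨n, hn⟩ := exists_zpow_eq_of_theta_eq_zero hp₀ hp (hne w) hw
    exact Set.mem_iUnion.2 ⟨n, by rw [Set.mem_ofPred_eq, ← hn, mul_div_cancel_left₀ _ hA]⟩
  unfold NonvanishingOnOpenDense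
  rw [hset]
  exact ⟨((isClosed_singleton.preimage hcont).isOpen_compl).preimage ℓ.continuous,
    (hcount.dense_compl ℂ).preimage (ℓ.isOpenMap hsurj)⟩

variable {q : ℝ} {x z : ℂ × ℂ → ℂ} {α β γ δ : ℂ}

lemma nonvanishingOnOpenDense_cDen (hq₀ : 0 < q) (hq₁ : q < 1) {s : ℝ} (hs : 0 < s)
    (κ lam ups sig : ℝ) (hx : ∀ v, x v = α * v.1 + β * v.2) (hz : ∀ v, z v = γ * v.1 + δ * v.2)
    (hαβ : α ≠ 0 ∨ β ≠ 0) (hγδ : γ ≠ 0 ∨ δ ≠ 0) :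
    NonvanishingOnOpenDense fun v => cDen (x v) (z v) κ lam ups sig q s := by
  have hp₀ := qpow_ne_zero q s
  have hp := norm_qpow_lt_one hq₀ hq₁ hs
  have hW : NonvanishingOnOpenDense fun v => W (x v) (z v) κ lam ups sig q s := by
    have : ∀ v, W (x v) (z v) κ lam ups sig q s ≠ 0 := fun v => qpow_ne_zero _ _
    unfold NonvanishingOnOpenDense
    simp only [ne_eq, this, not_false_eq_true, Set.ofPred_true]
    exact ⟨isOpen_univ, dense_univ⟩
  refine hW.mul (.mul ?_ ?_)
  · refine nonvanishingOnOpenDense_theta hq₀ hq₁ (α := -2 * γ) (β := -2 * δ) hp₀ hp one_ne_zero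
      (by simpa using hγδ) fun v => ?_
    rw [hz, one_mul]; congr 1; ring
  · exact nonvanishingOnOpenDense_theta hq₀ hq₁ hp₀ hp (neg_ne_zero.2 (qpow_ne_zero _ _)) hαβ
      fun v => by rw [hx]; rfl

lemma nonvanishingOnOpenDense_cNum (hq₀ : 0 < q) (hq₁ : q < 1) {s : ℝ} (hs : 0 < s)
    (κ lam ups sig : ℝ) (hx : ∀ v, x v = α * v.1 + β * v.2) (hz : ∀ v, z v = γ * v.1 + δ * v.2)
    (hγδ : γ ≠ 0 ∨ δ ≠ 0) (h : α - γ ≠ 0 ∨ β - δ ≠ 0) :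
    NonvanishingOnOpenDense fun v => cNum (x v) (z v) κ lam ups sig q s := by
  have hp₀ := qpow_ne_zero q s
  have hp := norm_qpow_lt_one hq₀ hq₁ hs
  have hz' : ∀ v, -z v = -γ * v.1 + -δ * v.2 := fun v => by rw [hz]; ring
  have hγδ' : -γ ≠ 0 ∨ -δ ≠ 0 := by simpa using hγδ
  refine .mul (.mul (.mul ?_ ?_) ?_) ?_
  · exact nonvanishingOnOpenDense_theta hq₀ hq₁ hp₀ hp (qpow_ne_zero _ _) hγδ'
      fun v => by rw [hz']; rfl
  · exact nonvanishingOnOpenDense_theta hq₀ hq₁ hp₀ hp (neg_ne_zero.2 (qpow_ne_zero _ _)) hγδ'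
      fun v => by rw [hz']; rfl
  · exact nonvanishingOnOpenDense_theta hq₀ hq₁ hp₀ hp (qpow_ne_zero _ _) hγδ'
      fun v => by rw [hz']; rfl
  · refine nonvanishingOnOpenDense_theta hq₀ hq₁ (A := dParam ups sig q s / aDual κ ups q) hp₀ hp
      (div_ne_zero (neg_ne_zero.2 (qpow_ne_zero _ _)) (qpow_ne_zero _ _)) h fun v => ?_
    rw [hx, hz, mul_div_right_comm]; congr 2; ring

lemma nonvanishingOnOpenDense_cFun (hq₀ : 0 < q) (hq₁ : q < 1) {s : ℝ} (hs : 0 < s)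
    (κ lam ups sig : ℝ) (hx : ∀ v, x v = α * v.1 + β * v.2) (hz : ∀ v, z v = γ * v.1 + δ * v.2)
    (hαβ : α ≠ 0 ∨ β ≠ 0) (hγδ : γ ≠ 0 ∨ δ ≠ 0) (h : α - γ ≠ 0 ∨ β - δ ≠ 0) :
    NonvanishingOnOpenDense fun v => cFun (x v) (z v) κ lam ups sig q s := by
  have H := (nonvanishingOnOpenDense_cNum hq₀ hq₁ hs κ lam ups sig hx hz hγδ h).mul
    (nonvanishingOnOpenDense_cDen hq₀ hq₁ hs κ lam ups sig hx hz hαβ hγδ)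
  unfold NonvanishingOnOpenDense at H ⊢
  -- As division by zero yields zero, `cFun` is nonzero exactly where numerator and denominator both
  -- are.
  simpa only [cFun, ne_eq, div_eq_zero_iff, mul_eq_zero] using H

lemma isOpen_dense_domain₁ (hq₀ : 0 < q) (hq₁ : q < 1) {s : ℝ} (hs : 0 < s) (κ lam : ℝ) :
    IsOpen (domain₁ κ lam q s) ∧ Dense (domain₁ κ lam q s) := by
  have hs₂ := half_pos hs
  have h1 := nonvanishingOnOpenDense_cDen hq₀ hq₁ hs κ lam κ lam
    (x := fun v => v.1) (z := fun v => -v.2) (α := 1) (β := 0) (γ := 0) (δ := -1)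
    (fun v => by ring) (fun v => by ring) (by norm_num) (by norm_num)
  have h2 := nonvanishingOnOpenDense_cDen hq₀ hq₁ hs κ κ lam lam
    (x := fun v => v.2) (z := fun v => -v.1) (α := 0) (β := 1) (γ := -1) (δ := 0)
    (fun v => by ring) (fun v => by ring) (by norm_num) (by norm_num)
  have h3 := nonvanishingOnOpenDense_cFun hq₀ hq₁ hs κ κ lam lam
    (x := fun v => v.2) (z := fun v => -v.1) (α := 0) (β := 1) (γ := -1) (δ := 0)
    (fun v => by ring) (fun v => by ring) (by norm_num) (by norm_num) (by norm_num)
  have h4 := nonvanishingOnOpenDense_cDen hq₀ hq₁ hs₂ κ lam 0 0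
    (x := fun v => v.1) (z := fun v => -v.2 / 2) (α := 1) (β := 0) (γ := 0) (δ := -1 / 2)
    (fun v => by ring) (fun v => by ring) (by norm_num) (by norm_num)
  have h5 := nonvanishingOnOpenDense_cDen hq₀ hq₁ hs₂ κ 0 lam 0
    (x := fun v => v.2 / 2) (z := fun v => -2 * v.1 / 2) (α := 0) (β := 1 / 2) (γ := -1) (δ := 0)
    (fun v => by ring) (fun v => by ring) (by norm_num) (by norm_num)
  have h6 := nonvanishingOnOpenDense_cFun hq₀ hq₁ hs₂ κ 0 lam 0
    (x := fun v => v.2 / 2) (z := fun v => -2 * v.1 / 2) (α := 0) (β := 1 / 2) (γ := -1) (δ := 0)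
    (fun v => by ring) (fun v => by ring) (by norm_num) (by norm_num) (by norm_num)
  have H := h1.mul (h2.mul (h3.mul (h4.mul (h5.mul h6))))
  unfold NonvanishingOnOpenDense at H
  simp only [mul_ne_zero_iff] at H
  exact H

lemma isOpen_dense_domain₂ (hq₀ : 0 < q) (hq₁ : q < 1) {s : ℝ} (hs : 0 < s) (κ lam : ℝ) :
    IsOpen (domain₂ κ lam q s) ∧ Dense (domain₂ κ lam q s) := by
  have hs₂ := half_pos hs
  have h1 := nonvanishingOnOpenDense_cDen hq₀ hq₁ hs κ lam κ lam
    (x := fun v => v.1) (z := fun v => v.2) (α := 1) (β := 0) (γ := 0) (δ := 1)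
    (fun v => by ring) (fun v => by ring) (by norm_num) (by norm_num)
  have h2 := nonvanishingOnOpenDense_cDen hq₀ hq₁ hs κ κ lam lam
    (x := fun v => v.2) (z := fun v => v.1) (α := 0) (β := 1) (γ := 1) (δ := 0)
    (fun v => by ring) (fun v => by ring) (by norm_num) (by norm_num)
  have h3 := nonvanishingOnOpenDense_cDen hq₀ hq₁ hs κ κ lam lam
    (x := fun v => v.2) (z := fun v => -v.1) (α := 0) (β := 1) (γ := -1) (δ := 0)
    (fun v => by ring) (fun v => by ring) (by norm_num) (by norm_num)
  have h4 := nonvanishingOnOpenDense_cFun hq₀ hq₁ hs κ κ lam lam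
    (x := fun v => v.2) (z := fun v => -v.1) (α := 0) (β := 1) (γ := -1) (δ := 0)
    (fun v => by ring) (fun v => by ring) (by norm_num) (by norm_num) (by norm_num)
  have h5 := nonvanishingOnOpenDense_cDen hq₀ hq₁ hs₂ κ lam 0 0
    (x := fun v => v.1) (z := fun v => v.2 / 2) (α := 1) (β := 0) (γ := 0) (δ := 1 / 2)
    (fun v => by ring) (fun v => by ring) (by norm_num) (by norm_num)
  have h6 := nonvanishingOnOpenDense_cDen hq₀ hq₁ hs₂ κ 0 lam 0
    (x := fun v => v.2 / 2) (z := fun v => 2 * v.1 / 2) (α := 0) (β := 1 / 2) (γ := 1) (δ := 0)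
    (fun v => by ring) (fun v => by ring) (by norm_num) (by norm_num)
  have h7 := nonvanishingOnOpenDense_cDen hq₀ hq₁ hs₂ κ 0 lam 0
    (x := fun v => v.2 / 2) (z := fun v => -2 * v.1 / 2) (α := 0) (β := 1 / 2) (γ := -1) (δ := 0)
    (fun v => by ring) (fun v => by ring) (by norm_num) (by norm_num)
  have h8 := nonvanishingOnOpenDense_cFun hq₀ hq₁ hs₂ κ 0 lam 0
    (x := fun v => v.2 / 2) (z := fun v => -2 * v.1 / 2) (α := 0) (β := 1 / 2) (γ := -1) (δ := 0)
    (fun v => by ring) (fun v => by ring) (by norm_num) (by norm_num) (by norm_num)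
  have H := h1.mul (h2.mul (h3.mul (h4.mul (h5.mul (h6.mul (h7.mul h8))))))
  unfold NonvanishingOnOpenDense at H
  simp only [mul_ne_zero_iff] at H
  exact H

end Density

end AskeyWilson

theorem mainTheorem5 (q s κ lam : ℝ) (hq₀ : 0 < q) (hq₁ : q < 1) (hs : 0 < s) :
    (IsOpen (domain₁ κ lam q s) ∧ Dense (domain₁ κ lam q s) ∧
      ∀ x z : ℂ, (x, z) ∈ domain₁ κ lam q s →
        specJ cFun κ lam q s x (-z) / specJDual cFun κ lam q s z (-x) =
          specR cFun κ lam q s x (-z) / specRDual cFun κ lam q s (z / 2) (-2 * x)) ∧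
    (IsOpen (domain₂ κ lam q s) ∧ Dense (domain₂ κ lam q s) ∧
      ∀ x z : ℂ, (x, z) ∈ domain₂ κ lam q s →
        (specJ cFun κ lam q s x z - specJDual cFun κ lam q s z x) /
            specJDual cFun κ lam q s z (-x) =
          (specR cFun κ lam q s x z - specRDual cFun κ lam q s (z / 2) (2 * x)) /
            specRDual cFun κ lam q s (z / 2) (-2 * x)) := by
  have h₁ := isOpen_dense_domain₁ hq₀ hq₁ hs κ lam
  have h₂ := isOpen_dense_domain₂ hq₀ hq₁ hs κ lam
  exact ⟨⟨h₁.1, h₁.2, fun _ _ h => cFun_quotient_eq hq₀ hq₁ hs h⟩,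
    h₂.1, h₂.2, fun _ _ h => cFun_quotient_sub_eq hq₀ hq₁ hs h⟩
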